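/- Let $n\ge 1$. A Borel probability measure $\mu$ on $\mathbb{R}^n$ is called log-concave if $\mu((1-\lambda)A+\lambda B)\ge \mu(A)^{1-\lambda}\mu(B)^{\lambda}$ for all Borel sets $A,B\subset\mathbb{R}^n$ and all $\lambda\in(0,1)$; a random vector is called log-concave if its distribution is. For a random vector $X$ in $\mathbb{R}^n$ let $$\Lambda_X(\xi)=\log\mathbb{E}\,e^{\langle X,\xi\rangle}\in(-\infty,\infty],\qquad \Lambda_X^\ast(x)=\sup_{\xi\in\mathbb{R}^n}\bigl(\langle x,\xi\rangle-\Lambda_X(\xi)\bigr)\in[0,\infty],\qquad \xi,x\in\mathbb{R}^n .$$ Let $\mathcal{E}$ be a random vector in $\mathbb{R}^n$ with the isotropic radial exponential distribution, that is, with density $$f_{\mathcal E}(x)=c_n e^{-\sqrt{n+1}\,|x|},\qquad c_n=\frac{(n+1)^{n/2}}{n\,\omega_n\,\Gamma(n)},$$ where $|\cdot|$ is the Euclidean norm and $\omega_n$ is the volume of the Euclidean unit ball of $\mathbb{R}^n$. Let $X$ be a log-concave random vector in $\mathbb{R}^n$ which is rotationally invariant (its distribution is invariant under every orthogonal transformation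 of $\mathbb{R}^n$) and non-degenerate (its distribution is not concentrated on an affine hyperplane). Then $$\mathbb{E}\,\Lambda_X^\ast(X)\ \ge\ \mathbb{E}\,\Lambda_{\mathcal E}^\ast(\mathcal E),$$ as an inequality in $[0,\infty]$. -/

import Mathlib

open MeasureTheory ProbabilityTheory
open scoped ENNReal Pointwise RealInnerProductSpace

noncomputable section

/-- A Borel measure `μ` on `ℝⁿ` is log-concave if
`μ((1-t)A + tB) ≥ μ(A)^(1-t) μ(B)^t` for all Borel sets `A`, `B` and all `t ∈ (0,1)`. -/
def IsLogConcaveMeasure {n : ℕ} (μ : Measure (EuclideanSpace ℝ (Fin n))) : Prop :=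
  ∀ A B : Set (EuclideanSpace ℝ (Fin n)), MeasurableSet A → MeasurableSet B →
    ∀ t : ℝ, 0 < t → t < 1 →
      μ A ^ (1 - t) * μ B ^ t ≤ μ ((1 - t) • A + t • B)

/-- `μ` is invariant under all linear isometries of `ℝⁿ`. -/
def IsRotationInvariant {n : ℕ} (μ : Measure (EuclideanSpace ℝ (Fin n))) : Prop :=
  ∀ U : EuclideanSpace ℝ (Fin n) ≃ₗᵢ[ℝ] EuclideanSpace ℝ (Fin n), μ.map U = μ

/-- `μ` is not concentrated on an affine hyperplane. -/
def IsNondegenerate {n : ℕ} (μ : Measure (EuclideanSpace ℝ (Fin n))) : Prop :=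
  ∀ θ : EuclideanSpace ℝ (Fin n), θ ≠ 0 → ∀ c : ℝ, μ {x | ⟪x, θ⟫ = c} < 1

/-- The cumulant generating function `Λ_μ(ξ) = log ∫ exp ⟨x, ξ⟩ dμ(x)`, with the value `+∞` where
the integral diverges. -/
def logLaplace {n : ℕ} (μ : Measure (EuclideanSpace ℝ (Fin n)))
    (ξ : EuclideanSpace ℝ (Fin n)) : EReal :=
  ENNReal.log (∫⁻ x, ENNReal.ofReal (Real.exp ⟪x, ξ⟫) ∂μ)

/-- The Cramér transform `Λ*_μ(x) = sup_ξ (⟨x, ξ⟩ - Λ_μ(ξ))`. -/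
def cramerTransform {n : ℕ} (μ : Measure (EuclideanSpace ℝ (Fin n)))
    (x : EuclideanSpace ℝ (Fin n)) : EReal :=
  ⨆ ξ : EuclideanSpace ℝ (Fin n), ((⟪x, ξ⟫ : ℝ) : EReal) - logLaplace μ ξ

/-- The normalising constant `c_n = (n+1)^(n/2) / (n ω_n Γ(n))`, with `ω_n` the volume of the
Euclidean unit ball of `ℝⁿ`. -/
def radialExpConst (n : ℕ) : ℝ :=
  ((n : ℝ) + 1) ^ ((n : ℝ) / 2) /
    (n * volume.real (Metric.closedBall (0 : EuclideanSpace ℝ (Fin n)) 1) * Real.Gamma n)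

/-- The isotropic radial exponential distribution on `ℝⁿ`, with density
`c_n exp(-√(n+1) |x|)`. -/
def radialExp (n : ℕ) : Measure (EuclideanSpace ℝ (Fin n)) :=
  volume.withDensity fun x =>
    ENNReal.ofReal (radialExpConst n * Real.exp (-(Real.sqrt ((n : ℝ) + 1) * ‖x‖)))

/-- The expectation `E Λ*_X(X)` in `[0, ∞]` of the Cramér transform of the law of `X`, evaluated
at `X`. For a probability law `Λ*_X ≥ 0`, so `EReal.toENNReal` changes no value. -/
def expectedCramer {n : ℕ} {Ω : Type*} [MeasurableSpace Ω] (P : Measure Ω)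
    (X : Ω → EuclideanSpace ℝ (Fin n)) : ℝ≥0∞ :=
  ∫⁻ ω, (cramerTransform (P.map X) (X ω)).toENNReal ∂P

end

/-! The proof compares `X` with the density proportional to `exp (-β|x|)`, where `β` is chosen so
that the second moments agree. Along a ray the logarithm of this density is affine, while that of a
radial log-concave density is concave. The set where the log-concave density is the larger one is
therefore an interval in `|x|`. Equal mass and equal second moment then give `E k(|X|²) ≤ E
k(|E_β|²)` for convex `k` satisfying mild integrability conditions, where `E_β` has the exponential
law (`integral_convex_comp_le`, `integral_convex_le`).

This comparison is used twice, with `N = (n+1)/2`. The Laplace transform of a rotation invariant law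
is the mean of a convex function of `|x|²`, so `Λ_X ≤ Λ_{E_β} = -N log (1 - |ξ|²/β²)`. Taking
Legendre transforms, `Λ*_X(x) ≥ radCramer N (β|x|)`, with equality for `E_β` itself. Moreover `u ↦
radCramer N (β√u)` is concave, so its mean under `X` is at least its mean under `E_β`. By scaling
the latter does not depend on `β`, and it equals `E Λ*_ℰ(ℰ)`.

Only measure log-concavity is assumed, so the comparison is applied to the convolution of the law
with the uniform law on a small ball, which has an explicit log-concave density; then the radius
tends to zero (`exists_exp_comparison`). -/

/-! ### The Legendre transform of `s ↦ -N log (1 - s²)` -/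

/-- The Legendre transform of `s ↦ -N log (1 - s²)`, in closed form. -/
noncomputable def radCramer (N r : ℝ) : ℝ :=
  √(N ^ 2 + r ^ 2) - N - N * Real.log ((N + √(N ^ 2 + r ^ 2)) / (2 * N))

lemma le_sqrt_sq_add_sq (N r : ℝ) : N ≤ √(N ^ 2 + r ^ 2) :=
  Real.le_sqrt_of_sq_le (by nlinarith [sq_nonneg r])

/-- With `q = √(N² + r²)`, so that `(q - N)(q + N) = r²`, this combines `log z ≤ z - 1` at `z = (1 -
s²)(N + q)/(2N)` with `(s(N + q) - r)² ≥ 0`. Both are equalities at `s = r/(N + q)`, the maximiser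
used in `exists_radCramer_eq`. -/
lemma add_mul_log_le_radCramer {N s : ℝ} (hN : 0 < N) (r : ℝ) (hs : s ^ 2 < 1) :
    s * r + N * Real.log (1 - s ^ 2) ≤ radCramer N r := by
  have hq := le_sqrt_sq_add_sq N r
  have hq2 : √(N ^ 2 + r ^ 2) ^ 2 = N ^ 2 + r ^ 2 := Real.sq_sqrt (by positivity)
  unfold radCramer
  set q := √(N ^ 2 + r ^ 2)
  have h1 : 0 < (N + q) / (2 * N) := by positivity
  have h2 : 0 < 1 - s ^ 2 := by linarith
  have h3 := Real.log_le_sub_one_of_pos (mul_pos h2 h1)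
  rw [Real.log_mul h2.ne' h1.ne'] at h3
  have h4 := mul_le_mul_of_nonneg_left h3 hN.le
  have h5 : N * ((1 - s ^ 2) * ((N + q) / (2 * N)) - 1) = (1 - s ^ 2) * (N + q) / 2 - N := by
    field_simp
  rw [h5] at h4
  have h6 : s * r - s ^ 2 * (N + q) / 2 ≤ (q - N) / 2 := by
    have : 0 < N + q := by positivity
    by_contra! h
    have := mul_lt_mul_of_pos_right h this
    nlinarith [sq_nonneg (s * (N + q) - r)]
  nlinarith

lemma exists_radCramer_eq {N r : ℝ} (hN : 0 < N) (hr : 0 ≤ r) :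
    ∃ s, 0 ≤ s ∧ s < 1 ∧ radCramer N r = s * r + N * Real.log (1 - s ^ 2) := by
  have hq := le_sqrt_sq_add_sq N r
  have hq2 : √(N ^ 2 + r ^ 2) ^ 2 = N ^ 2 + r ^ 2 := Real.sq_sqrt (by positivity)
  unfold radCramer
  set q := √(N ^ 2 + r ^ 2)
  have hp : 0 < N + q := by positivity
  refine ⟨r / (N + q), by positivity, ?_, ?_⟩
  · rw [div_lt_one hp]
    nlinarith
  · have h1 : 1 - (r / (N + q)) ^ 2 = ((N + q) / (2 * N))⁻¹ := by
      field_simp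
      nlinarith
    have h2 : r / (N + q) * r = q - N := by
      field_simp
      nlinarith
    rw [h1, h2, Real.log_inv]
    ring

lemma radCramer_nonneg {N : ℝ} (hN : 0 < N) (r : ℝ) : 0 ≤ radCramer N r := by
  simpa using add_mul_log_le_radCramer (s := 0) hN r (by norm_num)

/-- The maximising slope lies in `[0, 1)`, which gives a Lipschitz constant of one. -/
lemma radCramer_le_add_abs {N r : ℝ} (hN : 0 < N) (hr : 0 ≤ r) (r' : ℝ) :
    radCramer N r ≤ radCramer N r' + |r - r'| := by
  obtain ⟨s, hs0, hs1, h⟩ := exists_radCramer_eq hN hr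
  have h2 := add_mul_log_le_radCramer (s := s) hN r' (by nlinarith)
  have h3 : s * (r - r') ≤ |r - r'| :=
    (mul_le_mul_of_nonneg_left (le_abs_self _) hs0).trans
      (mul_le_of_le_one_left (abs_nonneg _) hs1.le)
  linarith

lemma radCramer_le {N r : ℝ} (hN : 0 < N) (hr : 0 ≤ r) : radCramer N r ≤ r := by
  have h := radCramer_le_add_abs hN hr 0
  have h0 : radCramer N 0 = 0 := by
    have : (N + N) / (2 * N) = 1 := by field_simp; norm_num
    simp [radCramer, Real.sqrt_sq hN.le, this]
  rwa [h0, sub_zero, abs_of_nonneg hr, zero_add] at h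

lemma continuous_radCramer {N : ℝ} (hN : 0 < N) : Continuous (radCramer N) := by
  unfold radCramer
  refine Continuous.sub (by fun_prop)
    (Continuous.mul continuous_const (Continuous.log (by fun_prop) ?_))
  intro r
  have := le_sqrt_sq_add_sq N r
  positivity

/-- Tangent-line bound for `radCramer` as a function of the square of its argument. -/
lemma radCramer_le_tangent {N : ℝ} (hN : 0 < N) (r r₀ : ℝ) :
    radCramer N r ≤ radCramer N r₀ + (r ^ 2 - r₀ ^ 2) / (2 * (N + √(N ^ 2 + r₀ ^ 2))) := by
  have hq := le_sqrt_sq_add_sq N r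
  have hq2 : √(N ^ 2 + r ^ 2) ^ 2 = N ^ 2 + r ^ 2 := Real.sq_sqrt (by positivity)
  have hp := le_sqrt_sq_add_sq N r₀
  have hp2 : √(N ^ 2 + r₀ ^ 2) ^ 2 = N ^ 2 + r₀ ^ 2 := Real.sq_sqrt (by positivity)
  unfold radCramer
  set q := √(N ^ 2 + r ^ 2)
  set p := √(N ^ 2 + r₀ ^ 2)
  have hNq : 0 < N + q := by positivity
  have hNp : 0 < N + p := by positivity
  have h1 := Real.one_sub_inv_le_log_of_pos (div_pos hNq hNp)
  rw [Real.log_div hNq.ne' hNp.ne'] at h1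
  rw [Real.log_div hNq.ne' (by positivity), Real.log_div hNp.ne' (by positivity)]
  have h2 := mul_le_mul_of_nonneg_left h1 hN.le
  -- Once the logarithm is bounded by `log y ≥ 1 - 1/y`, what remains of the gap between tangent and
  -- function is an explicit nonnegative fraction.
  have h3 : (r ^ 2 - r₀ ^ 2) / (2 * (N + p)) - (q - p) + N * (1 - ((N + q) / (N + p))⁻¹)
      = (q - p) ^ 2 * (q - N) / (2 * (N + p) * (N + q)) := by
    have : r ^ 2 - r₀ ^ 2 = q ^ 2 - p ^ 2 := by linarith
    rw [this]
    field_simp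
    ring
  have h4 : 0 ≤ (q - p) ^ 2 * (q - N) / (2 * (N + p) * (N + q)) :=
    div_nonneg (mul_nonneg (sq_nonneg _) (by linarith)) (by positivity)
  linarith

/-- The tangent is taken at the weighted mean of `u` and `v`, where the linear corrections cancel.
-/
lemma convexOn_neg_radCramer_sqrt {N : ℝ} (hN : 0 < N) (β : ℝ) :
    ConvexOn ℝ (Set.Ici 0) (fun u => -radCramer N (β * √u)) := by
  refine ⟨convex_Ici 0, fun u hu v hv a b ha hb hab => ?_⟩
  have hu : (0 : ℝ) ≤ u := hu
  have hv : (0 : ℝ) ≤ v := hv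
  have hw : 0 ≤ a * u + b * v := by positivity
  simp only [smul_eq_mul]
  set w := a * u + b * v
  have h1 := mul_le_mul_of_nonneg_left (radCramer_le_tangent hN (β * √u) (β * √w)) ha
  have h2 := mul_le_mul_of_nonneg_left (radCramer_le_tangent hN (β * √v) (β * √w)) hb
  simp only [mul_pow, Real.sq_sqrt hw, Real.sq_sqrt hu] at h1
  simp only [mul_pow, Real.sq_sqrt hw, Real.sq_sqrt hv] at h2
  set c := 2 * (N + √(N ^ 2 + β ^ 2 * w))
  have h3 : a * ((β ^ 2 * u - β ^ 2 * w) / c) + b * ((β ^ 2 * v - β ^ 2 * w) / c) = 0 := by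
    have : a * ((β ^ 2 * u - β ^ 2 * w) / c) + b * ((β ^ 2 * v - β ^ 2 * w) / c)
      = β ^ 2 * ((a * u + b * v) - (a + b) * w) / c := by ring
    rw [this, hab]; simp [w]
  have h4 : radCramer N (β * √w) = a * radCramer N (β * √w) + b * radCramer N (β * √w) := by
    rw [← add_mul, hab, one_mul]
  linarith

/-! ### The Laplace transform of `exp (-β|x|)` by Gaussian subordination -/

open Filter Topology in
lemma tendsto_integral_exp_neg_sq_atTop :
    Tendsto (fun y : ℝ => ∫ t in (0 : ℝ)..y, Real.exp (-t ^ 2)) atTop (𝓝 (√Real.pi / 2)) := by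
  have h := integral_gaussian_Ioi 1
  have hi : IntegrableOn (fun t : ℝ => Real.exp (-1 * t ^ 2)) (Set.Ioi 0) :=
    (integrable_exp_neg_mul_sq one_pos).integrableOn
  have := intervalIntegral_tendsto_integral_Ioi 0 hi tendsto_id
  rw [h] at this
  simpa using this

open Filter Topology in
lemma tendsto_integral_exp_neg_sq_atBot :
    Tendsto (fun y : ℝ => ∫ t in (0 : ℝ)..y, Real.exp (-t ^ 2)) atBot (𝓝 (-(√Real.pi / 2))) := by
  have h := (tendsto_integral_exp_neg_sq_atTop.comp tendsto_neg_atBot_atTop).neg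
  refine h.congr fun y => ?_
  have := intervalIntegral.integral_comp_neg (a := 0) (b := y) (fun t : ℝ => Real.exp (-t ^ 2))
  simp only [even_two, Even.neg_pow, neg_zero] at this
  simp only [Function.comp]
  rw [this, intervalIntegral.integral_symm, neg_neg]

lemma hasDerivAt_integral_exp_neg_sq (y : ℝ) :
    HasDerivAt (fun y : ℝ => ∫ t in (0 : ℝ)..y, Real.exp (-t ^ 2)) (Real.exp (-y ^ 2)) y := by
  have hc : Continuous fun t : ℝ => Real.exp (-t ^ 2) := by fun_prop
  exact intervalIntegral.integral_hasDerivAt_right (hc.intervalIntegrable _ _)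
    (hc.stronglyMeasurableAtFilter _ _) hc.continuousAt

open Filter Topology in
/-- The subordination integral behind the representation of `exp (-2ab)` as a mixture of
Gaussians in `b`. -/
lemma lintegral_exp_neg_sq_add_inv_sq {a b : ℝ} (ha : 0 < a) (hb : 0 < b) :
    ∫⁻ v in Set.Ioi (0 : ℝ), ENNReal.ofReal (Real.exp (-(a ^ 2 * v ^ 2 + b ^ 2 / v ^ 2))) =
      ENNReal.ofReal (√Real.pi / (2 * a) * Real.exp (-(2 * a * b))) := by
  set F : ℝ → ℝ := fun y => ∫ t in (0 : ℝ)..y, Real.exp (-t ^ 2) with hF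
  -- An antiderivative of `f`: since `(av ± b/v)² = a²v² + b²/v² ± 2ab`, the weights `exp (±2ab)`
  -- turn both Gaussian factors into `f v`, and the inner derivatives `a ∓ b/v²` add up to `2a`.
  set g₀ : ℝ → ℝ := fun v => (1 / (2 * a)) * (Real.exp (2 * a * b) * F (a * v + b / v) +
    Real.exp (-(2 * a * b)) * F (a * v - b / v)) with hg₀
  set l₀ : ℝ := (1 / (2 * a)) * (Real.exp (2 * a * b) * (√Real.pi / 2) +
    Real.exp (-(2 * a * b)) * (-(√Real.pi / 2))) with hl₀
  set l₁ : ℝ := (1 / (2 * a)) * (Real.exp (2 * a * b) * (√Real.pi / 2) +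
    Real.exp (-(2 * a * b)) * (√Real.pi / 2)) with hl₁
  set f : ℝ → ℝ := fun v => Real.exp (-(a ^ 2 * v ^ 2 + b ^ 2 / v ^ 2)) with hf
  have hderiv₀ : ∀ v ∈ Set.Ioi (0 : ℝ), HasDerivAt g₀ (f v) v := by
    intro v hv
    have hv : 0 < v := hv
    have h1 : HasDerivAt (fun v : ℝ => a * v + b / v) (a - b / v ^ 2) v := by
      have := ((hasDerivAt_id v).const_mul a).add ((hasDerivAt_inv hv.ne').const_mul b)
      exact this.congr_deriv (by ring)
    have h2 : HasDerivAt (fun v : ℝ => a * v - b / v) (a + b / v ^ 2) v := by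
      have := ((hasDerivAt_id v).const_mul a).sub ((hasDerivAt_inv hv.ne').const_mul b)
      exact this.congr_deriv (by ring)
    have h3 := (hasDerivAt_integral_exp_neg_sq (a * v + b / v)).comp v h1
    have h4 := (hasDerivAt_integral_exp_neg_sq (a * v - b / v)).comp v h2
    have h5 := ((h3.const_mul (Real.exp (2 * a * b))).add
      (h4.const_mul (Real.exp (-(2 * a * b))))).const_mul (1 / (2 * a))
    refine h5.congr_deriv ?_
    have e1 : Real.exp (-(a * v + b / v) ^ 2) = f v * Real.exp (-(2 * a * b)) := by
      rw [hf, ← Real.exp_add]; congr 1; field_simp; ring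
    have e2 : Real.exp (-(a * v - b / v) ^ 2) = f v * Real.exp (2 * a * b) := by
      rw [hf, ← Real.exp_add]; congr 1; field_simp; ring
    have e3 : Real.exp (2 * a * b) * Real.exp (-(2 * a * b)) = 1 := by
      rw [← Real.exp_add]; simp
    rw [e1, e2]
    have : 1 / (2 * a) * (Real.exp (2 * a * b) * (f v * Real.exp (-(2 * a * b)) * (a - b / v ^ 2)) +
        Real.exp (-(2 * a * b)) * (f v * Real.exp (2 * a * b) * (a + b / v ^ 2)))
        = (Real.exp (2 * a * b) * Real.exp (-(2 * a * b))) * (f v * (1 / (2 * a) * (2 * a))) := by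
      ring
    rw [this, e3]
    field_simp
  have hinv : Tendsto (fun v : ℝ => b / v) (𝓝[>] 0) atTop := by
    simpa [div_eq_mul_inv] using tendsto_inv_nhdsGT_zero.const_mul_atTop hb
  have hlin : Tendsto (fun v : ℝ => a * v) (𝓝[>] 0) (𝓝 0) := by
    have : Tendsto (fun v : ℝ => a * v) (𝓝 0) (𝓝 (a * 0)) := (continuous_const_mul a).tendsto 0
    rw [mul_zero] at this
    exact this.mono_left nhdsWithin_le_nhds
  have hlim₀ : Tendsto g₀ (𝓝[>] 0) (𝓝 l₀) := by
    refine Tendsto.const_mul _ (Tendsto.add (Tendsto.const_mul _ ?_) (Tendsto.const_mul _ ?_))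
    · exact tendsto_integral_exp_neg_sq_atTop.comp (hlin.add_atTop hinv)
    · refine tendsto_integral_exp_neg_sq_atBot.comp ?_
      simpa [sub_eq_add_neg] using hlin.add_atBot (tendsto_neg_atTop_atBot.comp hinv)
  have hinv' : Tendsto (fun v : ℝ => b / v) atTop (𝓝 0) := tendsto_const_nhds.div_atTop tendsto_id
  have hlin' : Tendsto (fun v : ℝ => a * v) atTop atTop := tendsto_id.const_mul_atTop ha
  have hlim₁ : Tendsto g₀ atTop (𝓝 l₁) := by
    refine Tendsto.const_mul _ (Tendsto.add (Tendsto.const_mul _ ?_) (Tendsto.const_mul _ ?_))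
    · exact tendsto_integral_exp_neg_sq_atTop.comp (hlin'.atTop_add hinv')
    · refine tendsto_integral_exp_neg_sq_atTop.comp ?_
      simpa [sub_eq_add_neg] using hlin'.atTop_add hinv'.neg
  -- Since `b / 0 = 0`, the value `g₀ 0` is not the limit from the right; it is replaced by `l₀` to
  -- make the antiderivative right-continuous.
  set g : ℝ → ℝ := Function.update g₀ 0 l₀ with hg
  have hcont : ContinuousWithinAt g (Set.Ici 0) 0 := by
    rw [hg, continuousWithinAt_update_same]
    simpa using hlim₀
  have hderiv : ∀ v ∈ Set.Ioi (0 : ℝ), HasDerivAt g (f v) v := by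
    intro v hv
    refine (hderiv₀ v hv).congr_of_eventuallyEq ?_
    filter_upwards [isOpen_Ioi.mem_nhds hv] with w hw
    exact Function.update_of_ne (ne_of_gt hw) _ _
  have hlim : Tendsto g atTop (𝓝 l₁) := by
    refine hlim₁.congr' ?_
    filter_upwards [eventually_gt_atTop 0] with w hw
    exact (Function.update_of_ne (ne_of_gt hw) _ _).symm
  have hnn : ∀ v ∈ Set.Ioi (0 : ℝ), 0 ≤ f v := fun v _ => (Real.exp_pos _).le
  have hint := integrableOn_Ioi_deriv_of_nonneg hcont hderiv hnn hlim
  have hval := integral_Ioi_of_hasDerivAt_of_nonneg hcont hderiv hnn hlim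
  rw [← ofReal_integral_eq_lintegral_ofReal hint (ae_of_all _ fun v => (Real.exp_pos _).le), hval]
  congr 1
  simp only [hg, Function.update_self, hl₀, hl₁]
  field_simp
  ring

variable {n : ℕ}

lemma lintegral_exp_inner_sub_sq_norm {c : ℝ} (hc : 0 < c) (ξ : EuclideanSpace ℝ (Fin n)) :
    ∫⁻ x : EuclideanSpace ℝ (Fin n), ENNReal.ofReal (Real.exp (⟪x, ξ⟫ - c * ‖x‖ ^ 2)) =
      ENNReal.ofReal ((Real.pi / c) ^ ((n : ℝ) / 2) * Real.exp (‖ξ‖ ^ 2 / (4 * c))) := by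
  have hi := GaussianFourier.integrable_cexp_neg_mul_sq_norm_add (b := (c : ℂ)) (by simpa) 1 ξ
  have hv := GaussianFourier.integral_cexp_neg_mul_sq_norm_add (b := (c : ℂ)) (by simpa) 1 ξ
  have he : (fun v : EuclideanSpace ℝ (Fin n) =>
      Complex.exp (-(c : ℂ) * (‖v‖ : ℂ) ^ 2 + 1 * ((⟪ξ, v⟫ : ℝ) : ℂ))) =
      fun v => ((Real.exp (⟪v, ξ⟫ - c * ‖v‖ ^ 2) : ℝ) : ℂ) := by
    ext v
    push_cast
    rw [real_inner_comm]
    congr 1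
    ring
  rw [he] at hi hv
  have hi' : Integrable fun v : EuclideanSpace ℝ (Fin n) => Real.exp (⟪v, ξ⟫ - c * ‖v‖ ^ 2) := by
    exact hi.re.congr (ae_of_all _ fun v => Complex.ofReal_re _)
  rw [← ofReal_integral_eq_lintegral_ofReal hi' (ae_of_all _ fun v => (Real.exp_pos _).le)]
  congr 1
  have h2 : (((Real.pi / c) ^ ((n : ℝ) / 2) * Real.exp (‖ξ‖ ^ 2 / (4 * c)) : ℝ) : ℂ) =
      (Real.pi / c : ℂ) ^ ((n : ℂ) / 2) * Complex.exp (1 ^ 2 * (‖ξ‖ : ℂ) ^ 2 / (4 * c)) := by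
    push_cast
    rw [Complex.ofReal_cpow (by positivity)]
    push_cast
    simp
  rw [integral_complex_ofReal] at hv
  apply Complex.ofReal_injective
  rw [hv, h2]
  simp

/-- The Laplace transform of `exp (-β|x|)`, written as a mixture of Gaussian ones. -/
lemma lintegral_exp_inner_mul_exp_neg_norm (hn : 1 ≤ n) {β : ℝ} (hβ : 0 < β)
    (ξ : EuclideanSpace ℝ (Fin n)) :
    ∫⁻ x : EuclideanSpace ℝ (Fin n),
        ENNReal.ofReal (Real.exp ⟪x, ξ⟫) * ENNReal.ofReal (Real.exp (-(β * ‖x‖))) =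
      ENNReal.ofReal (2 * β / √Real.pi * (4 * Real.pi) ^ ((n : ℝ) / 2)) *
        ∫⁻ v in Set.Ioi (0 : ℝ),
          ENNReal.ofReal (v ^ (n : ℝ) * Real.exp (-(β ^ 2 - ‖ξ‖ ^ 2) * v ^ (2 : ℝ))) := by
  have : Nonempty (Fin n) := ⟨⟨0, hn⟩⟩
  -- Subordination with `a = β` and `b = |x|/2`, which requires `x ≠ 0`. The Gaussian integral over
  -- `x` can then be computed for each fixed `v`.
  have hmix : ∀ᵐ x : EuclideanSpace ℝ (Fin n),
      ENNReal.ofReal (Real.exp ⟪x, ξ⟫) * ENNReal.ofReal (Real.exp (-(β * ‖x‖))) =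
      ∫⁻ v in Set.Ioi (0 : ℝ), ENNReal.ofReal (2 * β / √Real.pi) * (ENNReal.ofReal
        (Real.exp (-(β ^ 2 * v ^ 2))) *
          ENNReal.ofReal (Real.exp (⟪x, ξ⟫ - 1 / (4 * v ^ 2) * ‖x‖ ^ 2))) := by
    have h0 : ∀ᵐ x : EuclideanSpace ℝ (Fin n), x ≠ 0 := by
      simp [ae_iff]
    filter_upwards [h0] with x hx
    have hx : 0 < ‖x‖ := norm_pos_iff.2 hx
    have h := lintegral_exp_neg_sq_add_inv_sq hβ (half_pos hx)
    have e : ENNReal.ofReal (Real.exp (-(β * ‖x‖))) = ENNReal.ofReal (2 * β / √Real.pi) *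
      ENNReal.ofReal (√Real.pi / (2 * β) * Real.exp (-(2 * β * (‖x‖ / 2)))) := by
      rw [← ENNReal.ofReal_mul (by positivity)]
      congr 1
      have : √Real.pi ≠ 0 := by positivity
      field_simp
    rw [lintegral_const_mul _ (by fun_prop), e, ← h, mul_left_comm,
      ← lintegral_const_mul _ (by fun_prop)]
    congr 1
    refine lintegral_congr fun v => ?_
    rw [← ENNReal.ofReal_mul (by positivity), ← ENNReal.ofReal_mul (by positivity),
      ← Real.exp_add, ← Real.exp_add]
    congr 2
    ring
  rw [lintegral_congr_ae hmix, lintegral_lintegral_swap (by fun_prop)]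
  rw [ENNReal.ofReal_mul (by positivity), mul_assoc, ← lintegral_const_mul _ (by fun_prop),
    ← lintegral_const_mul _ (by fun_prop)]
  refine setLIntegral_congr_fun measurableSet_Ioi fun v hv => ?_
  have hv : 0 < v := hv
  rw [lintegral_const_mul _ (by fun_prop), lintegral_const_mul _ (by fun_prop),
    lintegral_exp_inner_sub_sq_norm (by positivity)]
  congr 1
  rw [← ENNReal.ofReal_mul (by positivity), ← ENNReal.ofReal_mul (by positivity)]
  congr 1
  have h1 : (Real.pi / (1 / (4 * v ^ 2))) ^ ((n : ℝ) / 2) =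
      (4 * Real.pi) ^ ((n : ℝ) / 2) * v ^ (n : ℝ) := by
    have : Real.pi / (1 / (4 * v ^ 2)) = 4 * Real.pi * v ^ (2 : ℝ) := by
      rw [Real.rpow_two]; field_simp
    rw [this, Real.mul_rpow (by positivity) (by positivity), ← Real.rpow_mul hv.le]
    congr 2
    ring
  have h2 : Real.exp (-(β ^ 2 * v ^ 2)) * Real.exp (‖ξ‖ ^ 2 / (4 * (1 / (4 * v ^ 2)))) =
      Real.exp (-(β ^ 2 - ‖ξ‖ ^ 2) * v ^ (2 : ℝ)) := by
    rw [← Real.exp_add, Real.rpow_two]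
    congr 1
    field_simp
    ring
  rw [h1, ← h2]
  ring

lemma lintegral_rpow_mul_exp_neg_mul_sq {δ : ℝ} (hδ : 0 < δ) (n : ℕ) :
    ∫⁻ v in Set.Ioi (0 : ℝ), ENNReal.ofReal (v ^ (n : ℝ) * Real.exp (-δ * v ^ (2 : ℝ))) =
      ENNReal.ofReal (δ ^ (-(((n : ℝ) + 1) / 2)) * (1 / 2 * Real.Gamma (((n : ℝ) + 1) / 2))) := by
  have hn : (-1 : ℝ) < n := by have : (0 : ℝ) ≤ n := n.cast_nonneg; linarith
  rw [← ofReal_integral_eq_lintegral_ofReal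
    (integrableOn_rpow_mul_exp_neg_mul_rpow hn (by norm_num) hδ)
    ((ae_restrict_iff' measurableSet_Ioi).2 (ae_of_all _ fun v hv =>
      mul_nonneg (Real.rpow_nonneg (le_of_lt hv) _) (Real.exp_pos _).le)),
    integral_rpow_mul_exp_neg_mul_rpow (by norm_num) hn hδ]
  congr 1
  rw [neg_div]
  ring

/-- The mixture formula is an identity in `[0, ∞]`, so divergence is visible in the `v`-integral.
This restricts the supremum defining the Cramér transform of the exponential law to `‖ξ‖ < β`. -/
lemma lintegral_exp_inner_mul_exp_neg_norm_eq_top (hn : 1 ≤ n) {β : ℝ} (hβ : 0 < β)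
    {ξ : EuclideanSpace ℝ (Fin n)} (hξ : β ≤ ‖ξ‖) :
    ∫⁻ x : EuclideanSpace ℝ (Fin n),
        ENNReal.ofReal (Real.exp ⟪x, ξ⟫) * ENNReal.ofReal (Real.exp (-(β * ‖x‖))) = ∞ := by
  rw [lintegral_exp_inner_mul_exp_neg_norm hn hβ]
  refine ENNReal.mul_eq_top.2 (Or.inl ⟨?_, ?_⟩)
  · have : 0 < 2 * β / √Real.pi * (4 * Real.pi) ^ ((n : ℝ) / 2) := by positivity
    simpa using this
  · rw [eq_top_iff]
    calc ∞ = ∫⁻ _ in Set.Ioi (1 : ℝ), 1 := by simp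
      _ ≤ ∫⁻ v in Set.Ioi (1 : ℝ),
          ENNReal.ofReal (v ^ (n : ℝ) * Real.exp (-(β ^ 2 - ‖ξ‖ ^ 2) * v ^ (2 : ℝ))) := by
        refine setLIntegral_mono' measurableSet_Ioi fun v hv => ?_
        have hv : 1 < v := hv
        rw [ENNReal.one_le_ofReal]
        refine one_le_mul_of_one_le_of_one_le (Real.one_le_rpow hv.le (by positivity)) ?_
        refine Real.one_le_exp (mul_nonneg ?_ (by positivity))
        nlinarith
      _ ≤ _ := lintegral_mono_set (Set.Ioi_subset_Ioi zero_le_one)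

/-- Comparison with the mixture formula at `ξ = 0` eliminates all constants; the exponent `(n+1)/2`
comes from the integral of `v ^ n exp (-δv²)`. -/
lemma lintegral_exp_inner_mul_exp_neg_norm_eq (hn : 1 ≤ n) {β : ℝ} (hβ : 0 < β)
    {ξ : EuclideanSpace ℝ (Fin n)} (hξ : ‖ξ‖ < β) :
    ∫⁻ x : EuclideanSpace ℝ (Fin n),
        ENNReal.ofReal (Real.exp ⟪x, ξ⟫) * ENNReal.ofReal (Real.exp (-(β * ‖x‖))) =
      (∫⁻ x : EuclideanSpace ℝ (Fin n), ENNReal.ofReal (Real.exp (-(β * ‖x‖)))) *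
        ENNReal.ofReal ((1 - (‖ξ‖ / β) ^ 2) ^ (-(((n : ℝ) + 1) / 2))) := by
  have hδ : 0 < β ^ 2 - ‖ξ‖ ^ 2 := by nlinarith [norm_nonneg ξ]
  have h0 := lintegral_exp_inner_mul_exp_neg_norm hn hβ (0 : EuclideanSpace ℝ (Fin n))
  simp only [inner_zero_right, Real.exp_zero, ENNReal.ofReal_one, one_mul, norm_zero, ne_eq,
    OfNat.ofNat_ne_zero, not_false_eq_true, zero_pow, sub_zero] at h0
  rw [h0, lintegral_exp_inner_mul_exp_neg_norm hn hβ, lintegral_rpow_mul_exp_neg_mul_sq hδ,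
    lintegral_rpow_mul_exp_neg_mul_sq (by positivity), mul_assoc]
  congr 1
  have hs : 0 < 1 - (‖ξ‖ / β) ^ 2 := by
    rw [div_pow, sub_pos, div_lt_one (by positivity)]; linarith
  have hΓ : 0 < Real.Gamma (((n : ℝ) + 1) / 2) := Real.Gamma_pos_of_pos (by positivity)
  rw [← ENNReal.ofReal_mul (by positivity)]
  congr 1
  have : β ^ 2 - ‖ξ‖ ^ 2 = β ^ 2 * (1 - (‖ξ‖ / β) ^ 2) := by field_simp
  rw [this, Real.mul_rpow (by positivity) hs.le]
  ring

lemma lintegral_exp_neg_norm_lt_top (hn : 1 ≤ n) {β : ℝ} (hβ : 0 < β) :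
    ∫⁻ x : EuclideanSpace ℝ (Fin n), ENNReal.ofReal (Real.exp (-(β * ‖x‖))) < ∞ := by
  have h0 := lintegral_exp_inner_mul_exp_neg_norm hn hβ (0 : EuclideanSpace ℝ (Fin n))
  simp only [inner_zero_right, Real.exp_zero, ENNReal.ofReal_one, one_mul, norm_zero, ne_eq,
    OfNat.ofNat_ne_zero, not_false_eq_true, zero_pow, sub_zero] at h0
  rw [h0, lintegral_rpow_mul_exp_neg_mul_sq (by positivity)]
  exact ENNReal.mul_lt_top ENNReal.ofReal_lt_top ENNReal.ofReal_lt_top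

/-! ### Convex ordering from two crossings -/

/-- The affine function is the chord of `k` over `[a, b]`, which lies above `k` inside and below it
outside. -/
lemma ConvexOn.exists_affine_crossing {k : ℝ → ℝ} (hk : ConvexOn ℝ (Set.Ici 0) k) {a b : ℝ}
    (ha : 0 ≤ a) (hab : a < b) :
    ∃ A B : ℝ, (∀ u, a ≤ u → u ≤ b → k u ≤ A + B * u) ∧
      (∀ u, 0 ≤ u → u ≤ a → A + B * u ≤ k u) ∧ (∀ u, b ≤ u → A + B * u ≤ k u) := by
  have hb : 0 ≤ b := ha.trans hab.le
  have hba : 0 < b - a := sub_pos.2 hab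
  refine ⟨(b * k a - a * k b) / (b - a), (k b - k a) / (b - a), fun u hau hub => ?_,
    fun u hu hua => ?_, fun u hbu => ?_⟩
  · have h := hk.2 (Set.mem_Ici.2 ha) (Set.mem_Ici.2 hb)
      (show 0 ≤ (b - u) / (b - a) from div_nonneg (by linarith) hba.le)
      (show 0 ≤ (u - a) / (b - a) from div_nonneg (by linarith) hba.le) (by field_simp; ring)
    simp only [smul_eq_mul] at h
    have e : (b - u) / (b - a) * a + (u - a) / (b - a) * b = u := by field_simp; ring
    rw [e] at h
    refine h.trans (le_of_eq ?_)
    field_simp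
    ring
  · have hbu : 0 < b - u := by linarith
    have h := hk.2 (Set.mem_Ici.2 hu) (Set.mem_Ici.2 hb)
      (show 0 ≤ (b - a) / (b - u) from div_nonneg (by linarith) hbu.le)
      (show 0 ≤ (a - u) / (b - u) from div_nonneg (by linarith) hbu.le) (by field_simp; ring)
    simp only [smul_eq_mul] at h
    have e : (b - a) / (b - u) * u + (a - u) / (b - u) * b = a := by field_simp; ring
    rw [e, div_mul_eq_mul_div, div_mul_eq_mul_div, ← add_div, le_div_iff₀ hbu] at h
    rw [div_mul_eq_mul_div, ← add_div, div_le_iff₀ hba]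
    nlinarith
  · have hua : 0 < u - a := by linarith
    have h := hk.2 (Set.mem_Ici.2 ha) (Set.mem_Ici.2 (hb.trans hbu))
      (show 0 ≤ (u - b) / (u - a) from div_nonneg (by linarith) hua.le)
      (show 0 ≤ (b - a) / (u - a) from div_nonneg (by linarith) hua.le) (by field_simp; ring)
    simp only [smul_eq_mul] at h
    have e : (u - b) / (u - a) * a + (b - a) / (u - a) * u = b := by field_simp; ring
    rw [e, div_mul_eq_mul_div, div_mul_eq_mul_div, ← add_div, le_div_iff₀ hua] at h
    rw [div_mul_eq_mul_div, ← add_div, div_le_iff₀ hba]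
    nlinarith

/-- Convex ordering from a double crossing of densities: if `D` and `p` have the same mass and the
same first moment of `q`, and `{p ≤ D}` is an interval in terms of `q`, then `D` is dominated by
`p` on convex functions of `q`. -/
lemma integral_convex_comp_le {α : Type*} [MeasurableSpace α] {ν : Measure α} {q D p : α → ℝ}
    (hq : ∀ x, 0 ≤ q x) (hD : ∀ x, 0 ≤ D x) (hDi : Integrable D ν) (hpi : Integrable p ν)
    (hqD : Integrable (fun x => q x * D x) ν) (hqp : Integrable (fun x => q x * p x) ν)
    (h0 : ∫ x, D x ∂ν = ∫ x, p x ∂ν) (h1 : ∫ x, q x * D x ∂ν = ∫ x, q x * p x ∂ν)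
    (hnull : ∀ c, ν {x | q x = c} = 0)
    (hS : ∀ x y z, q x ≤ q y → q y ≤ q z → p x ≤ D x → p z ≤ D z → p y ≤ D y)
    {k : ℝ → ℝ} (hk : ConvexOn ℝ (Set.Ici 0) k) {A₀ B₀ : ℝ}
    (hlow : ∀ u, 0 ≤ u → A₀ + B₀ * u ≤ k u)
    (hkm : AEStronglyMeasurable (fun x => k (q x)) ν)
    (hkp : Integrable (fun x => k (q x) * p x) ν) :
    Integrable (fun x => k (q x) * D x) ν ∧
      ∫ x, k (q x) * D x ∂ν ≤ ∫ x, k (q x) * p x ∂ν := by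
  have of_ae : D =ᵐ[ν] p → Integrable (fun x => k (q x) * D x) ν ∧
      ∫ x, k (q x) * D x ∂ν ≤ ∫ x, k (q x) * p x ∂ν := by
    intro h
    have h' : (fun x => k (q x) * p x) =ᵐ[ν] fun x => k (q x) * D x := by
      filter_upwards [h] with x hx
      rw [hx]
    exact ⟨hkp.congr h', (integral_congr_ae h').symm.le⟩
  have hDp : Integrable (fun x => D x - p x) ν := hDi.sub hpi
  have hqDp : Integrable (fun x => q x * D x - q x * p x) ν := hqD.sub hqp
  have hDp0 : ∫ x, (D x - p x) ∂ν = 0 := by rw [integral_sub hDi hpi, h0, sub_self]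
  have hqDp0 : ∫ x, (q x * D x - q x * p x) ∂ν = 0 := by rw [integral_sub hqD hqp, h1, sub_self]
  have hne : ∀ c, ∀ᵐ x ∂ν, q x ≠ c := fun c => by
    rw [ae_iff]; simpa using hnull c
  -- If no two such points have different values of `q`, then `D < p` off a single null level set,
  -- and equality of the masses forces `D = p` almost everywhere.
  by_cases hdeg : ∃ x z, p x ≤ D x ∧ p z ≤ D z ∧ q x < q z
  swap
  · push Not at hdeg
    refine of_ae ?_
    have hle : ∀ᵐ x ∂ν, 0 ≤ p x - D x := by
      by_cases hex : ∃ x, p x ≤ D x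
      · obtain ⟨x₀, hx₀⟩ := hex
        filter_upwards [hne (q x₀)] with x hx
        by_contra! h
        have hx' : p x ≤ D x := by linarith
        exact hx (le_antisymm (hdeg x₀ x hx₀ hx') (hdeg x x₀ hx' hx₀))
      · push Not at hex
        exact ae_of_all _ fun x => by linarith [hex x]
    have := (integral_eq_zero_iff_of_nonneg_ae hle (hpi.sub hDi)).1
      (by rw [integral_sub hpi hDi, h0, sub_self])
    filter_upwards [this] with x hx
    have : p x - D x = 0 := hx
    linarith
  obtain ⟨x₁, z₁, hx₁, hz₁, hlt⟩ := hdeg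
  set T : Set ℝ := q '' {x | p x ≤ D x} with hT
  have hTx : q x₁ ∈ T := ⟨x₁, hx₁, rfl⟩
  have hTz : q z₁ ∈ T := ⟨z₁, hz₁, rfl⟩
  have hbelow : BddBelow T := ⟨0, by rintro _ ⟨x, -, rfl⟩; exact hq x⟩
  set a := sInf T with ha
  have ha0 : 0 ≤ a := le_csInf ⟨_, hTx⟩ (by rintro _ ⟨x, -, rfl⟩; exact hq x)
  have hlta : ∀ y, q y < a → D y < p y := fun y hy => by
    by_contra! h
    exact absurd (csInf_le hbelow ⟨y, h, rfl⟩) (not_le.2 hy)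
  have hagt : ∀ y, a < q y → ∃ x, p x ≤ D x ∧ q x < q y := fun y hy => by
    obtain ⟨_, ⟨x, hx, rfl⟩, hxy⟩ := exists_lt_of_csInf_lt ⟨_, hTx⟩ hy
    exact ⟨x, hx, hxy⟩
  -- With `T` unbounded there is only one crossing, at `a`: then `(q - a)(D - p)` is nonnegative
  -- with zero integral, so again `D = p` almost everywhere.
  by_cases hbdd : BddAbove T
  swap
  · refine of_ae ?_
    have hnn : ∀ x, 0 ≤ (q x * D x - q x * p x) - a * (D x - p x) := by
      intro x
      have e : (q x * D x - q x * p x) - a * (D x - p x) = (q x - a) * (D x - p x) := by ring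
      rw [e]
      rcases lt_trichotomy (q x) a with h | h | h
      · exact (mul_pos_of_neg_of_neg (by linarith) (by linarith [hlta x h])).le
      · simp [h]
      · obtain ⟨y, hy, hyx⟩ := hagt x h
        obtain ⟨_, ⟨z, hz, rfl⟩, hxz⟩ := not_bddAbove_iff.1 hbdd (q x)
        exact mul_nonneg (by linarith) (by linarith [hS y x z hyx.le hxz.le hy hz])
    have hz := (integral_eq_zero_iff_of_nonneg_ae (ae_of_all _ hnn)
      (hqDp.sub (hDp.const_mul a))).1 (by
        rw [integral_sub hqDp (hDp.const_mul a), integral_const_mul, hDp0, hqDp0, mul_zero,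
          sub_zero])
    filter_upwards [hz, hne a] with x hx hxa
    have hx' : (q x - a) * (D x - p x) = 0 := by
      have : (q x * D x - q x * p x) - a * (D x - p x) = 0 := hx
      linarith
    rcases mul_eq_zero.1 hx' with h | h
    · exact absurd (by linarith) hxa
    · linarith
  set b := sSup T with hb
  have hab : a < b := (csInf_le hbelow hTx).trans_lt (hlt.trans_le (le_csSup hbdd hTz))
  obtain ⟨A, B, hin, hleft, hright⟩ := hk.exists_affine_crossing ha0 hab
  -- `k ∘ q` minus the chord has sign opposite to `D - p`, and the chord integrates to zero against
  -- `D - p` by the two moment conditions.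
  have hpt : ∀ᵐ x ∂ν, k (q x) * D x ≤
      k (q x) * p x + (A * (D x - p x) + B * (q x * D x - q x * p x)) := by
    filter_upwards [hne a, hne b] with x hxa hxb
    suffices h : (k (q x) - (A + B * q x)) * (D x - p x) ≤ 0 by linarith
    rcases lt_or_gt_of_ne hxa with h | h
    · exact mul_nonpos_of_nonneg_of_nonpos (by linarith [hleft _ (hq x) h.le])
        (by linarith [hlta x h])
    · rcases lt_or_gt_of_ne hxb with h' | h'
      · obtain ⟨y, hy, hyx⟩ := hagt x h
        obtain ⟨_, ⟨z, hz, rfl⟩, hxz⟩ := exists_lt_of_lt_csSup ⟨_, hTx⟩ h'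
        exact mul_nonpos_of_nonpos_of_nonneg (by linarith [hin _ h.le h'.le])
          (by linarith [hS y x z hyx.le hxz.le hy hz])
      · refine mul_nonpos_of_nonneg_of_nonpos (by linarith [hright _ h'.le]) ?_
        by_contra! hc
        exact absurd (le_csSup hbdd ⟨x, (by linarith : p x ≤ D x), rfl⟩) (not_le.2 h')
  have hI : Integrable (fun x => A * (D x - p x) + B * (q x * D x - q x * p x)) ν :=
    (hDp.const_mul A).add (hqDp.const_mul B)
  have hkD : Integrable (fun x => k (q x) * D x) ν := by
    refine integrable_of_le_of_le (hkm.mul hDi.aestronglyMeasurable) (ae_of_all _ fun x => ?_) hpt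
      ((hDi.const_mul A₀).add (hqD.const_mul B₀)) (hkp.add hI)
    have := mul_le_mul_of_nonneg_right (hlow _ (hq x)) (hD x)
    simp only [Pi.add_apply]
    linarith
  refine ⟨hkD, (integral_mono_ae hkD (hkp.add hI) hpt).trans (le_of_eq ?_)⟩
  refine (integral_add hkp hI).trans ?_
  rw [integral_add (hDp.const_mul A) (hqDp.const_mul B), integral_const_mul, integral_const_mul,
    hDp0, hqDp0, mul_zero, mul_zero, add_zero, add_zero]

/-! ### Rotation invariance and spherical averages of exponentials -/

lemma hasSum_cosh_mul_sqrt (c : ℝ) {u : ℝ} (hu : 0 ≤ u) :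
    HasSum (fun m : ℕ => (c ^ 2) ^ m / (2 * m).factorial * u ^ m) (Real.cosh (c * √u)) := by
  convert Real.hasSum_cosh (c * √u) using 2 with m
  rw [pow_mul, mul_pow, Real.sq_sqrt hu, mul_pow]
  ring

/-- A power series in `u` with nonnegative coefficients is convex on `u ≥ 0`. The symmetrisation
from `exp` to `cosh` matters: `exp (c√u)` with `c > 0` is concave near zero. -/
lemma convexOn_cosh_mul_sqrt (c : ℝ) :
    ConvexOn ℝ (Set.Ici 0) (fun u => Real.cosh (c * √u)) := by
  refine ⟨convex_Ici 0, fun u hu v hv a b ha hb hab => ?_⟩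
  have hu' : (0 : ℝ) ≤ u := hu
  have hv' : (0 : ℝ) ≤ v := hv
  simp only [smul_eq_mul]
  refine hasSum_le (fun m => ?_) (hasSum_cosh_mul_sqrt c (by positivity : 0 ≤ a * u + b * v))
    (((hasSum_cosh_mul_sqrt c hu').mul_left a).add ((hasSum_cosh_mul_sqrt c hv').mul_left b))
  have h := (convexOn_pow m).2 hu hv ha hb hab
  simp only [smul_eq_mul] at h
  have := mul_le_mul_of_nonneg_left h
    (by positivity : (0 : ℝ) ≤ (c ^ 2) ^ m / (2 * m).factorial)
  linarith

lemma exists_linearIsometryEquiv_apply_eq {x y : EuclideanSpace ℝ (Fin n)} (h : ‖x‖ = ‖y‖) :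
    ∃ U : EuclideanSpace ℝ (Fin n) ≃ₗᵢ[ℝ] EuclideanSpace ℝ (Fin n), U x = y :=
  ⟨_, Submodule.reflection_sub h⟩

lemma IsRotationInvariant.lintegral_comp {ν : Measure (EuclideanSpace ℝ (Fin n))}
    (hν : IsRotationInvariant ν)
    (U : EuclideanSpace ℝ (Fin n) ≃ₗᵢ[ℝ] EuclideanSpace ℝ (Fin n))
    {f : EuclideanSpace ℝ (Fin n) → ℝ≥0∞} (hf : Measurable f) :
    ∫⁻ x, f (U x) ∂ν = ∫⁻ x, f x ∂ν := by
  conv_rhs => rw [← hν U]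
  rw [lintegral_map hf U.continuous.measurable]

lemma IsRotationInvariant.lintegral_exp_inner_congr {ν : Measure (EuclideanSpace ℝ (Fin n))}
    (hν : IsRotationInvariant ν) {ξ η : EuclideanSpace ℝ (Fin n)} (h : ‖ξ‖ = ‖η‖) :
    ∫⁻ x, ENNReal.ofReal (Real.exp ⟪x, ξ⟫) ∂ν = ∫⁻ x, ENNReal.ofReal (Real.exp ⟪x, η⟫) ∂ν := by
  obtain ⟨U, hU⟩ := exists_linearIsometryEquiv_apply_eq h
  rw [← hν.lintegral_comp U (f := fun x => ENNReal.ofReal (Real.exp ⟪x, η⟫)) (by fun_prop)]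
  simp [← hU]

lemma IsRotationInvariant.withDensity_volume {D : EuclideanSpace ℝ (Fin n) → ℝ≥0∞}
    (hDm : Measurable D) (hD : ∀ x y, ‖x‖ = ‖y‖ → D x = D y) :
    IsRotationInvariant (volume.withDensity D) := by
  intro U
  ext s hs
  rw [Measure.map_apply U.continuous.measurable hs,
    withDensity_apply _ (U.continuous.measurable hs), withDensity_apply _ hs,
    ← lintegral_indicator (U.continuous.measurable hs), ← lintegral_indicator hs,
    ← U.measurePreserving.lintegral_comp (hDm.indicator hs)]
  refine lintegral_congr fun x => ?_
  by_cases hx : U x ∈ s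
  · simp [hx, hD x (U x) (by simp)]
  · simp [hx]

/-- The uniform law on the unit ball is projected radially; the projection commutes with linear
isometries. -/
lemma exists_rotationInvariant_sphere (hn : 1 ≤ n) :
    ∃ σ : Measure (EuclideanSpace ℝ (Fin n)), IsProbabilityMeasure σ ∧ IsRotationInvariant σ ∧
      ∀ᵐ θ ∂σ, ‖θ‖ = 1 := by
  have : Nonempty (Fin n) := ⟨⟨0, hn⟩⟩
  set B : Set (EuclideanSpace ℝ (Fin n)) := Metric.closedBall 0 1
  set ρ : Measure (EuclideanSpace ℝ (Fin n)) := (volume B)⁻¹ • volume.restrict B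
  have hB0 : volume B ≠ 0 := (Metric.measure_closedBall_pos _ _ one_pos).ne'
  have hBt : volume B ≠ ∞ := measure_closedBall_lt_top.ne
  have hρ : IsProbabilityMeasure ρ := ⟨by simp [ρ, ENNReal.inv_mul_cancel hB0 hBt]⟩
  have hm : Measurable fun x : EuclideanSpace ℝ (Fin n) => ‖x‖⁻¹ • x := by fun_prop
  refine ⟨ρ.map fun x => ‖x‖⁻¹ • x, Measure.isProbabilityMeasure_map hm.aemeasurable, ?_, ?_⟩
  · intro U
    have hU := U.continuous.measurable
    have hUρ : ρ.map U = ρ := by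
      have h := (U.measurePreserving.restrict_preimage
        (Metric.isClosed_closedBall (x := (0 : EuclideanSpace ℝ (Fin n))) (ε := 1)).measurableSet)
      have hB : U ⁻¹' B = B := by ext x; simp [B]
      rw [hB] at h
      rw [Measure.map_smul, h.map_eq]
    rw [Measure.map_map hU hm]
    conv_rhs => rw [← hUρ, Measure.map_map hm hU]
    congr 1
    ext x : 1
    simp
  · rw [ae_map_iff hm.aemeasurable (measurableSet_eq_fun (by fun_prop) (by fun_prop))]
    have h0 : ∀ᵐ x : EuclideanSpace ℝ (Fin n), x ≠ 0 := by simp [ae_iff]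
    refine Measure.ae_smul_measure ?_ _
    filter_upwards [ae_restrict_of_ae h0] with x hx
    rw [norm_smul, norm_inv, norm_norm, inv_mul_cancel₀ (norm_ne_zero_iff.2 hx)]

/-- The spherical average of `cosh (s √u ⟨e, θ⟩)`. -/
noncomputable def sphereCosh (σ : Measure (EuclideanSpace ℝ (Fin n)))
    (e : EuclideanSpace ℝ (Fin n)) (s u : ℝ) : ℝ :=
  ∫ θ, Real.cosh (s * ⟪θ, e⟫ * √u) ∂σ

section sphere

variable {σ : Measure (EuclideanSpace ℝ (Fin n))} {e : EuclideanSpace ℝ (Fin n)}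

lemma abs_inner_le_norm_of_sphere (hσ : ∀ᵐ θ ∂σ, ‖θ‖ = 1) (η : EuclideanSpace ℝ (Fin n)) :
    ∀ᵐ θ ∂σ, |⟪θ, η⟫| ≤ ‖η‖ := by
  filter_upwards [hσ] with θ hθ
  simpa [hθ] using abs_real_inner_le_norm θ η

lemma cosh_mul_inner_mul_sqrt_le (hσ : ∀ᵐ θ ∂σ, ‖θ‖ = 1) (he : ‖e‖ = 1) {s : ℝ} (hs : 0 ≤ s)
    (u : ℝ) : ∀ᵐ θ ∂σ, Real.cosh (s * ⟪θ, e⟫ * √u) ≤ Real.exp (s * √u) := by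
  filter_upwards [abs_inner_le_norm_of_sphere hσ e] with θ hθ
  rw [he] at hθ
  have h1 : |s * ⟪θ, e⟫ * √u| ≤ s * √u := by
    rw [abs_mul, abs_mul, abs_of_nonneg hs, abs_of_nonneg (Real.sqrt_nonneg u)]
    exact mul_le_mul_of_nonneg_right (mul_le_of_le_one_right hs hθ) (Real.sqrt_nonneg u)
  refine (Real.cosh_le_cosh.2 (h1.trans (le_abs_self _))).trans ?_
  rw [Real.cosh_eq]
  have : Real.exp (-(s * √u)) ≤ Real.exp (s * √u) :=
    Real.exp_le_exp.2 (neg_le_self (by positivity))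
  linarith

lemma sphereCosh_nonneg (s u : ℝ) : 0 ≤ sphereCosh σ e s u :=
  integral_nonneg fun _ => (Real.cosh_pos _).le

variable [IsProbabilityMeasure σ]

lemma integrable_cosh_mul_inner_mul_sqrt (hσ : ∀ᵐ θ ∂σ, ‖θ‖ = 1) (he : ‖e‖ = 1) {s : ℝ}
    (hs : 0 ≤ s) (u : ℝ) : Integrable (fun θ => Real.cosh (s * ⟪θ, e⟫ * √u)) σ := by
  refine Integrable.of_bound (C := Real.exp (s * √u)) (by fun_prop) ?_
  filter_upwards [cosh_mul_inner_mul_sqrt_le hσ he hs u] with θ hθ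
  rwa [Real.norm_of_nonneg (Real.cosh_pos _).le]

lemma sphereCosh_le (hσ : ∀ᵐ θ ∂σ, ‖θ‖ = 1) (he : ‖e‖ = 1) {s : ℝ} (hs : 0 ≤ s) (u : ℝ) :
    sphereCosh σ e s u ≤ Real.exp (s * √u) := by
  have := integral_mono_ae (integrable_cosh_mul_inner_mul_sqrt hσ he hs u)
    (integrable_const (Real.exp (s * √u))) (cosh_mul_inner_mul_sqrt_le hσ he hs u)
  simpa [sphereCosh] using this

lemma convexOn_sphereCosh (hσ : ∀ᵐ θ ∂σ, ‖θ‖ = 1) (he : ‖e‖ = 1) {s : ℝ} (hs : 0 ≤ s) :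
    ConvexOn ℝ (Set.Ici 0) (sphereCosh σ e s) := by
  refine ⟨convex_Ici 0, fun u hu v hv a b ha hb hab => ?_⟩
  simp only [sphereCosh, smul_eq_mul]
  rw [← integral_const_mul, ← integral_const_mul, ← integral_add
    ((integrable_cosh_mul_inner_mul_sqrt hσ he hs u).const_mul a)
    ((integrable_cosh_mul_inner_mul_sqrt hσ he hs v).const_mul b)]
  refine integral_mono (integrable_cosh_mul_inner_mul_sqrt hσ he hs _)
    (((integrable_cosh_mul_inner_mul_sqrt hσ he hs u).const_mul a).add
    ((integrable_cosh_mul_inner_mul_sqrt hσ he hs v).const_mul b)) fun θ => ?_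
  exact (convexOn_cosh_mul_sqrt (s * ⟪θ, e⟫)).2 hu hv ha hb hab

lemma measurable_sphereCosh (σ : Measure (EuclideanSpace ℝ (Fin n))) [IsProbabilityMeasure σ]
    (e : EuclideanSpace ℝ (Fin n)) (s : ℝ) : Measurable (sphereCosh σ e s) := by
  have h : StronglyMeasurable fun z : ℝ × EuclideanSpace ℝ (Fin n) =>
      Real.cosh (s * ⟪z.2, e⟫ * √z.1) := by
    apply Continuous.stronglyMeasurable
    fun_prop
  exact h.integral_prod_right.measurable

lemma lintegral_exp_inner_sphere (hrot : IsRotationInvariant σ) (hσ : ∀ᵐ θ ∂σ, ‖θ‖ = 1)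
    (η : EuclideanSpace ℝ (Fin n)) :
    ∫⁻ θ, ENNReal.ofReal (Real.exp ⟪θ, η⟫) ∂σ =
      ENNReal.ofReal (∫ θ, Real.cosh ⟪θ, η⟫ ∂σ) := by
  have hi : ∀ η : EuclideanSpace ℝ (Fin n), Integrable (fun θ => Real.exp ⟪θ, η⟫) σ := by
    intro η
    refine Integrable.of_bound (C := Real.exp ‖η‖) (by fun_prop) ?_
    filter_upwards [abs_inner_le_norm_of_sphere hσ η] with θ hθ
    rw [Real.norm_of_nonneg (Real.exp_pos _).le]
    exact Real.exp_le_exp.2 ((le_abs_self _).trans hθ)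
  have hl : ∀ η : EuclideanSpace ℝ (Fin n), ∫⁻ θ, ENNReal.ofReal (Real.exp ⟪θ, η⟫) ∂σ =
      ENNReal.ofReal (∫ θ, Real.exp ⟪θ, η⟫ ∂σ) := fun η =>
    (ofReal_integral_eq_lintegral_ofReal (hi η) (ae_of_all _ fun _ => (Real.exp_pos _).le)).symm
  have hneg : ∫ θ, Real.exp ⟪θ, η⟫ ∂σ = ∫ θ, Real.exp ⟪θ, -η⟫ ∂σ := by
    have h := hrot.lintegral_exp_inner_congr (norm_neg η).symm
    rwa [hl, hl, ENNReal.ofReal_eq_ofReal_iff (integral_nonneg fun _ => (Real.exp_pos _).le)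
      (integral_nonneg fun _ => (Real.exp_pos _).le)] at h
  rw [hl]
  congr 1
  simp_rw [Real.cosh_eq]
  have h2 := integral_add (hi η) (hi (-η))
  simp only [inner_neg_right] at h2 hneg
  rw [integral_div, h2, ← hneg]
  ring

/-- The Laplace transform of a rotation invariant measure is the integral of a function of the
norm that is convex in the squared norm. -/
lemma IsRotationInvariant.lintegral_exp_inner_eq {ν : Measure (EuclideanSpace ℝ (Fin n))}
    [SFinite ν] (hν : IsRotationInvariant ν) (hrot : IsRotationInvariant σ)
    (hσ : ∀ᵐ θ ∂σ, ‖θ‖ = 1) (he : ‖e‖ = 1) (ξ : EuclideanSpace ℝ (Fin n)) :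
    ∫⁻ x, ENNReal.ofReal (Real.exp ⟪x, ξ⟫) ∂ν =
      ∫⁻ x, ENNReal.ofReal (sphereCosh σ e ‖ξ‖ (‖x‖ ^ 2)) ∂ν := by
  -- Invariance of `ν` allows averaging over all directions of `ξ`; after Tonelli, invariance of `σ`
  -- allows `x` to be replaced by `‖x‖ • e`.
  calc ∫⁻ x, ENNReal.ofReal (Real.exp ⟪x, ξ⟫) ∂ν
      = ∫⁻ _, (∫⁻ x, ENNReal.ofReal (Real.exp ⟪x, ξ⟫) ∂ν) ∂σ := by simp
    _ = ∫⁻ θ, (∫⁻ x, ENNReal.ofReal (Real.exp ⟪x, ‖ξ‖ • θ⟫) ∂ν) ∂σ := by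
      refine lintegral_congr_ae ?_
      filter_upwards [hσ] with θ hθ
      exact hν.lintegral_exp_inner_congr (by simp [norm_smul, hθ])
    _ = ∫⁻ x, (∫⁻ θ, ENNReal.ofReal (Real.exp ⟪x, ‖ξ‖ • θ⟫) ∂σ) ∂ν :=
      lintegral_lintegral_swap (by fun_prop)
    _ = _ := by
      refine lintegral_congr fun x => ?_
      have h1 : ∀ θ : EuclideanSpace ℝ (Fin n), ⟪x, ‖ξ‖ • θ⟫ = ⟪θ, ‖ξ‖ • x⟫ := fun θ => by
        rw [real_inner_smul_right, real_inner_smul_right, real_inner_comm]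
      simp_rw [h1]
      rw [hrot.lintegral_exp_inner_congr (η := (‖ξ‖ * ‖x‖) • e) (by simp [norm_smul, he]),
        lintegral_exp_inner_sphere hrot hσ]
      congr 1
      rw [sphereCosh]
      congr 1
      ext θ
      rw [real_inner_smul_right, Real.sqrt_sq (norm_nonneg x)]
      congr 1
      ring

end sphere

/-! ### The densities proportional to `exp (-β|x|)` -/

lemma integrable_exp_neg_mul_norm (hn : 1 ≤ n) {c : ℝ} (hc : 0 < c) :
    Integrable fun x : EuclideanSpace ℝ (Fin n) => Real.exp (-(c * ‖x‖)) := by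
  refine ⟨by fun_prop, ?_⟩
  rw [hasFiniteIntegral_iff_ofReal (ae_of_all _ fun _ => (Real.exp_pos _).le)]
  exact lintegral_exp_neg_norm_lt_top hn hc

lemma integrable_sq_norm_mul_exp_neg_mul_norm (hn : 1 ≤ n) {c : ℝ} (hc : 0 < c) :
    Integrable fun x : EuclideanSpace ℝ (Fin n) => ‖x‖ ^ 2 * Real.exp (-(c * ‖x‖)) := by
  refine ((integrable_exp_neg_mul_norm hn (half_pos hc)).const_mul (8 / c ^ 2)).mono'
    (by fun_prop) (ae_of_all _ fun x => ?_)
  rw [Real.norm_of_nonneg (by positivity)]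
  have h := Real.quadratic_le_exp_of_nonneg (by positivity : 0 ≤ c / 2 * ‖x‖)
  have h1 : ‖x‖ ^ 2 ≤ 8 / c ^ 2 * Real.exp (c / 2 * ‖x‖) := by
    have : ‖x‖ ^ 2 = 8 / c ^ 2 * ((c / 2 * ‖x‖) ^ 2 / 2) := by field_simp; norm_num
    rw [this]
    gcongr
    have : 0 ≤ c / 2 * ‖x‖ := by positivity
    linarith
  have h2 : Real.exp (-(c / 2 * ‖x‖)) = Real.exp (c / 2 * ‖x‖) * Real.exp (-(c * ‖x‖)) := by
    rw [← Real.exp_add]; congr 1; ring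
  rw [h2, ← mul_assoc]
  gcongr

/-- The mean of `Φ (|x|)` under the density proportional to `exp (-|x|)`. -/
noncomputable def expMean (n : ℕ) (Φ : ℝ → ℝ) : ℝ :=
  (∫ x : EuclideanSpace ℝ (Fin n), Φ ‖x‖ * Real.exp (-‖x‖)) /
    ∫ x : EuclideanSpace ℝ (Fin n), Real.exp (-‖x‖)

lemma integral_exp_neg_norm_pos (hn : 1 ≤ n) :
    0 < ∫ x : EuclideanSpace ℝ (Fin n), Real.exp (-‖x‖) := by
  have := integrable_exp_neg_mul_norm hn one_pos
  simp only [one_mul] at this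
  exact integral_exp_pos this

/-- The probability density proportional to `exp (-β|x|)`. -/
noncomputable def expDensity (β : ℝ) (x : EuclideanSpace ℝ (Fin n)) : ℝ :=
  β ^ n / (∫ y : EuclideanSpace ℝ (Fin n), Real.exp (-‖y‖)) * Real.exp (-(β * ‖x‖))

/-- Because the right side is free of `β`, the law of `X` need not be normalised to be isotropic. -/
lemma integral_mul_expDensity {β : ℝ} (hβ : 0 < β) (Φ : ℝ → ℝ) :
    ∫ x : EuclideanSpace ℝ (Fin n), Φ (β * ‖x‖) * expDensity β x = expMean n Φ := by
  have h := Measure.integral_comp_smul_of_nonneg volume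
    (fun x : EuclideanSpace ℝ (Fin n) => Φ ‖x‖ * Real.exp (-‖x‖)) β (hR := hβ.le)
  simp only [norm_smul, Real.norm_of_nonneg hβ.le, finrank_euclideanSpace, Fintype.card_fin,
    smul_eq_mul] at h
  simp only [expDensity, expMean]
  have e : ∀ x : EuclideanSpace ℝ (Fin n), Φ (β * ‖x‖) * (β ^ n /
      (∫ y : EuclideanSpace ℝ (Fin n), Real.exp (-‖y‖)) * Real.exp (-(β * ‖x‖))) = β ^ n /
      (∫ y : EuclideanSpace ℝ (Fin n), Real.exp (-‖y‖)) *
        (Φ (β * ‖x‖) * Real.exp (-(β * ‖x‖))) := fun x => by ring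
  simp_rw [e]
  rw [integral_const_mul, h]
  have : β ^ n ≠ 0 := by positivity
  field_simp

lemma expDensity_pos (hn : 1 ≤ n) {β : ℝ} (hβ : 0 < β) (x : EuclideanSpace ℝ (Fin n)) :
    0 < expDensity β x :=
  mul_pos (div_pos (by positivity) (integral_exp_neg_norm_pos hn)) (Real.exp_pos _)

lemma integrable_expDensity (hn : 1 ≤ n) {β : ℝ} (hβ : 0 < β) :
    Integrable (expDensity (n := n) β) :=
  (integrable_exp_neg_mul_norm hn hβ).const_mul _

lemma measurable_expDensity (β : ℝ) : Measurable (expDensity (n := n) β) := by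
  unfold expDensity
  fun_prop

lemma integral_expDensity (hn : 1 ≤ n) {β : ℝ} (hβ : 0 < β) :
    ∫ x, expDensity (n := n) β x = 1 := by
  have h := integral_mul_expDensity (n := n) hβ fun _ => 1
  simp only [one_mul] at h
  rw [h, expMean]
  simp only [one_mul]
  exact div_self (integral_exp_neg_norm_pos hn).ne'

lemma integrable_sq_norm_mul_expDensity (hn : 1 ≤ n) {β : ℝ} (hβ : 0 < β) :
    Integrable fun x : EuclideanSpace ℝ (Fin n) => ‖x‖ ^ 2 * expDensity β x := by
  refine ((integrable_sq_norm_mul_exp_neg_mul_norm hn hβ).const_mul (β ^ n /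
      (∫ y : EuclideanSpace ℝ (Fin n), Real.exp (-‖y‖)))).congr (ae_of_all _ fun x => ?_)
  simp only [expDensity]
  ring

lemma integral_sq_norm_mul_expDensity {β : ℝ} (hβ : 0 < β) :
    ∫ x : EuclideanSpace ℝ (Fin n), ‖x‖ ^ 2 * expDensity β x
      = expMean n (fun r => r ^ 2) / β ^ 2 := by
  rw [← integral_mul_expDensity hβ, ← integral_div]
  congr 1
  ext x
  field_simp

lemma expMean_sq_pos (hn : 1 ≤ n) : 0 < expMean n (fun r => r ^ 2) := by
  refine div_pos ?_ (integral_exp_neg_norm_pos hn)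
  have : Nonempty (Fin n) := ⟨⟨0, hn⟩⟩
  have hi := integrable_sq_norm_mul_exp_neg_mul_norm hn one_pos
  simp only [one_mul] at hi
  rw [integral_pos_iff_support_of_nonneg (fun x => by positivity) hi]
  have hs : (Function.support fun x : EuclideanSpace ℝ (Fin n) => ‖x‖ ^ 2 * Real.exp (-‖x‖)) =
      {0}ᶜ := by
    ext x; simp [Real.exp_ne_zero]
  rw [hs]
  refine isOpen_compl_singleton.measure_pos _ ?_
  obtain ⟨x, hx⟩ := exists_ne (0 : EuclideanSpace ℝ (Fin n))
  exact ⟨x, hx⟩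

lemma lintegral_exp_inner_mul_expDensity (hn : 1 ≤ n) {β : ℝ} (hβ : 0 < β)
    {ξ : EuclideanSpace ℝ (Fin n)} (hξ : ‖ξ‖ < β) :
    ∫⁻ x, ENNReal.ofReal (Real.exp ⟪x, ξ⟫) * ENNReal.ofReal (expDensity β x) =
      ENNReal.ofReal ((1 - (‖ξ‖ / β) ^ 2) ^ (-(((n : ℝ) + 1) / 2))) := by
  set A := β ^ n / (∫ y : EuclideanSpace ℝ (Fin n), Real.exp (-‖y‖))
  have hA : 0 < A := div_pos (by positivity) (integral_exp_neg_norm_pos hn)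
  have h1 : ∀ x : EuclideanSpace ℝ (Fin n), ENNReal.ofReal (expDensity β x) =
      ENNReal.ofReal A * ENNReal.ofReal (Real.exp (-(β * ‖x‖))) := fun x => by
    rw [← ENNReal.ofReal_mul hA.le]; rfl
  have h2 : ENNReal.ofReal A * ∫⁻ x : EuclideanSpace ℝ (Fin n),
      ENNReal.ofReal (Real.exp (-(β * ‖x‖))) = 1 := by
    rw [← lintegral_const_mul _ (by fun_prop)]
    simp_rw [← h1]
    rw [← ofReal_integral_eq_lintegral_ofReal (integrable_expDensity hn hβ)
      (ae_of_all _ fun x => (expDensity_pos hn hβ x).le), integral_expDensity hn hβ,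
      ENNReal.ofReal_one]
  have h3 : ∀ x : EuclideanSpace ℝ (Fin n),
      ENNReal.ofReal (Real.exp ⟪x, ξ⟫) * ENNReal.ofReal (expDensity β x) = ENNReal.ofReal A *
        (ENNReal.ofReal (Real.exp ⟪x, ξ⟫) * ENNReal.ofReal (Real.exp (-(β * ‖x‖)))) := fun x => by
    rw [h1, mul_left_comm]
  simp_rw [h3]
  rw [lintegral_const_mul _ (by fun_prop), lintegral_exp_inner_mul_exp_neg_norm_eq hn hβ hξ,
    ← mul_assoc, h2, one_mul]

lemma radCramer_mul_sqrt_le {N β u : ℝ} (hN : 0 < N) (hβ : 0 < β) (hu : 0 ≤ u) :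
    radCramer N (β * √u) ≤ β + β * u := by
  have h1 := radCramer_le hN (by positivity : 0 ≤ β * √u)
  have h2 : √u ≤ 1 + u := by nlinarith [Real.sq_sqrt hu, sq_nonneg (√u - 1)]
  nlinarith

lemma integrable_radCramer_mul_expDensity (hn : 1 ≤ n) {N β : ℝ} (hβ : 0 < β) (hN : 0 < N) :
    Integrable fun x : EuclideanSpace ℝ (Fin n) => radCramer N (β * ‖x‖) * expDensity β x := by
  have hG := continuous_radCramer hN
  refine (((integrable_expDensity hn hβ).add
    (integrable_sq_norm_mul_expDensity hn hβ)).const_mul β).mono'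
    ((by fun_prop : Continuous fun x : EuclideanSpace ℝ (Fin n) =>
      radCramer N (β * ‖x‖)).measurable.mul
      (measurable_expDensity β)).aestronglyMeasurable (ae_of_all _ fun x => ?_)
  rw [norm_mul, Real.norm_of_nonneg (radCramer_nonneg hN _),
    Real.norm_of_nonneg (expDensity_pos hn hβ x).le]
  have h1 := radCramer_mul_sqrt_le hN hβ (sq_nonneg ‖x‖)
  rw [Real.sqrt_sq (norm_nonneg x)] at h1
  have := mul_le_mul_of_nonneg_right h1 (expDensity_pos hn hβ x).le
  simp only [Pi.add_apply]
  linarith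

/-! ### Radial log-concave densities and their comparison with the exponential -/

/-- A radial log-concave probability density on `ℝⁿ`. -/
structure IsRadialLogConcaveDensity (D : EuclideanSpace ℝ (Fin n) → ℝ) : Prop where
  measurable : Measurable D
  nonneg : ∀ x, 0 ≤ D x
  lintegral_eq_one : ∫⁻ x, ENNReal.ofReal (D x) = 1
  radial : ∀ x y, ‖x‖ = ‖y‖ → D x = D y
  logConcave : ∀ x y, ∀ t : ℝ, 0 < t → t < 1 → D x ^ (1 - t) * D y ^ t ≤ D ((1 - t) • x + t • y)

namespace IsRadialLogConcaveDensity

variable {D : EuclideanSpace ℝ (Fin n) → ℝ}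

lemma le_apply_zero (h : IsRadialLogConcaveDensity D) (x : EuclideanSpace ℝ (Fin n)) :
    D x ≤ D 0 := by
  have h1 := h.logConcave x (-x) (1 / 2) (by norm_num) (by norm_num)
  have h2 : ((1 : ℝ) - 1 / 2) • x + (1 / 2 : ℝ) • -x = 0 := by
    rw [smul_neg, ← sub_eq_add_neg, ← sub_smul]; norm_num
  rwa [h2, h.radial (-x) x (norm_neg x), ← Real.rpow_add' (h.nonneg x) (by norm_num),
    sub_add_cancel, Real.rpow_one] at h1

lemma exists_lt_apply_zero (hn : 1 ≤ n) (h : IsRadialLogConcaveDensity D) :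
    ∃ x, D x < D 0 := by
  have : Nonempty (Fin n) := ⟨⟨0, hn⟩⟩
  by_contra! hc
  have he : ∀ x, D x = D 0 := fun x => le_antisymm (h.le_apply_zero x) (hc x)
  have h1 := h.lintegral_eq_one
  simp_rw [he] at h1
  rw [lintegral_const, measure_univ_of_isAddLeftInvariant] at h1
  rcases eq_or_ne (ENNReal.ofReal (D 0)) 0 with h0 | h0
  · simp [h0] at h1
  · simp [ENNReal.mul_top h0] at h1

/-- By concavity of `log D` along a ray, a strict drop between `0` and `x₀` persists as linear decay
beyond `x₀`. This yields finite second moments. -/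
lemma exists_exp_bound (hn : 1 ≤ n) (h : IsRadialLogConcaveDensity D) :
    ∃ C c, 0 < c ∧ ∀ x, D x ≤ C * Real.exp (-(c * ‖x‖)) := by
  obtain ⟨x₀, hx₀⟩ := h.exists_lt_apply_zero hn
  have hD0 : 0 < D 0 := (h.nonneg x₀).trans_lt hx₀
  have hr : 0 < ‖x₀‖ := norm_pos_iff.2 fun h0 => by simp [h0] at hx₀
  -- The ratio is averaged with `1` so that `log q` makes sense even when `D x₀ = 0`.
  set q := (D x₀ / D 0 + 1) / 2 with hq
  have hq0 : 0 ≤ D x₀ / D 0 := div_nonneg (h.nonneg _) hD0.le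
  have hq1 : D x₀ / D 0 < 1 := (div_lt_one hD0).2 hx₀
  have hqpos : 0 < q := by linarith
  have hqlt : q < 1 := by linarith
  have hDq : D x₀ ≤ q * D 0 := by
    rw [← div_le_iff₀ hD0]; linarith
  have hlog : Real.log q < 0 := Real.log_neg hqpos hqlt
  refine ⟨D 0 / q, -Real.log q / ‖x₀‖, div_pos (by linarith) hr, fun x => ?_⟩
  rcases le_or_gt ‖x‖ ‖x₀‖ with hx | hx
  · refine (h.le_apply_zero x).trans ?_
    have h1 : q ≤ Real.exp (-(-Real.log q / ‖x₀‖ * ‖x‖)) := by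
      rw [← Real.log_le_iff_le_exp hqpos]
      have : ‖x‖ / ‖x₀‖ ≤ 1 := (div_le_one hr).2 hx
      have e : -(-Real.log q / ‖x₀‖ * ‖x‖) = Real.log q * (‖x‖ / ‖x₀‖) := by ring
      rw [e]
      nlinarith
    calc D 0 = D 0 / q * q := by field_simp
      _ ≤ _ := by gcongr
  · rcases (h.nonneg x).eq_or_lt with h0 | hpos
    · rw [← h0]; positivity
    have hx0 : 0 < ‖x‖ := hr.trans hx
    have ht0 : 0 < ‖x₀‖ / ‖x‖ := by positivity
    have ht1 : ‖x₀‖ / ‖x‖ < 1 := (div_lt_one hx0).2 hx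
    have h1 := h.logConcave 0 x (‖x₀‖ / ‖x‖) ht0 ht1
    rw [smul_zero, zero_add, h.radial ((‖x₀‖ / ‖x‖) • x) x₀
      (by rw [norm_smul, Real.norm_of_nonneg ht0.le, div_mul_cancel₀ _ hx0.ne'])] at h1
    have h2 := Real.log_le_log (by positivity) (h1.trans hDq)
    rw [Real.log_mul (by positivity) (by positivity), Real.log_mul hqpos.ne' hD0.ne',
      Real.log_rpow hD0, Real.log_rpow hpos] at h2
    have h3 : Real.log (D x) ≤ Real.log (D 0) + Real.log q * (‖x‖ / ‖x₀‖) := by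
      have h4 : ‖x₀‖ / ‖x‖ * (Real.log (D x) - Real.log (D 0)) ≤ Real.log q := by linarith
      have h5 := mul_le_mul_of_nonneg_right h4 (by positivity : 0 ≤ ‖x‖ / ‖x₀‖)
      have h6 : ‖x₀‖ / ‖x‖ * (Real.log (D x) - Real.log (D 0)) * (‖x‖ / ‖x₀‖) =
          Real.log (D x) - Real.log (D 0) := by field_simp
      linarith
    rw [Real.log_le_iff_le_exp hpos, Real.exp_add, Real.exp_log hD0] at h3
    have e : -(-Real.log q / ‖x₀‖ * ‖x‖) = Real.log q * (‖x‖ / ‖x₀‖) := by ring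
    rw [e]
    refine h3.trans (mul_le_mul_of_nonneg_right ?_ (Real.exp_pos _).le)
    exact (le_div_iff₀ hqpos).2 (mul_le_of_le_one_right hD0.le hqlt.le)

lemma integrable (h : IsRadialLogConcaveDensity D) : Integrable D :=
  ⟨h.measurable.aestronglyMeasurable, by
    rw [hasFiniteIntegral_iff_ofReal (ae_of_all _ h.nonneg), h.lintegral_eq_one]
    exact ENNReal.one_lt_top⟩

lemma integral_eq_one (h : IsRadialLogConcaveDensity D) : ∫ x, D x = 1 := by
  rw [integral_eq_lintegral_of_nonneg_ae (ae_of_all _ h.nonneg)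
    h.measurable.aestronglyMeasurable, h.lintegral_eq_one, ENNReal.toReal_one]

lemma integrable_sq_norm_mul (hn : 1 ≤ n) (h : IsRadialLogConcaveDensity D) :
    Integrable fun x => ‖x‖ ^ 2 * D x := by
  obtain ⟨C, c, hc, hb⟩ := h.exists_exp_bound hn
  refine ((integrable_sq_norm_mul_exp_neg_mul_norm hn hc).const_mul C).mono'
    ((by fun_prop : Measurable fun x : EuclideanSpace ℝ (Fin n) => ‖x‖ ^ 2).mul
      h.measurable).aestronglyMeasurable (ae_of_all _ fun x => ?_)
  rw [Real.norm_of_nonneg (mul_nonneg (by positivity) (h.nonneg x)), mul_left_comm]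
  exact mul_le_mul_of_nonneg_left (hb x) (by positivity)

/-- On a ray `log D` is concave and the logarithm of `expDensity β` is affine, so an inequality at
two radii passes to all radii between them. -/
lemma expDensity_le_of_between (hn : 1 ≤ n) (h : IsRadialLogConcaveDensity D) {β : ℝ} (hβ : 0 < β)
    {x y z : EuclideanSpace ℝ (Fin n)} (hxy : ‖x‖ ^ 2 ≤ ‖y‖ ^ 2) (hyz : ‖y‖ ^ 2 ≤ ‖z‖ ^ 2)
    (hx : expDensity β x ≤ D x) (hz : expDensity β z ≤ D z) : expDensity β y ≤ D y := by
  have hrad : ∀ u v : EuclideanSpace ℝ (Fin n), ‖u‖ = ‖v‖ → expDensity β u = expDensity β v :=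
    fun u v huv => by simp [expDensity, huv]
  have hxy := le_of_sq_le_sq hxy (norm_nonneg y)
  have hyz := le_of_sq_le_sq hyz (norm_nonneg z)
  rcases hxy.eq_or_lt with hxy' | hxy'
  · rwa [← hrad _ _ hxy', ← h.radial _ _ hxy']
  rcases hyz.eq_or_lt with hyz' | hyz'
  · rwa [hrad _ _ hyz', h.radial _ _ hyz']
  have hxz : 0 < ‖z‖ - ‖x‖ := by linarith
  set t := (‖y‖ - ‖x‖) / (‖z‖ - ‖x‖) with ht
  have ht0 : 0 < t := div_pos (by linarith) hxz
  have ht1 : t < 1 := (div_lt_one hxz).2 (by linarith)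
  have hty : (1 - t) * ‖x‖ + t * ‖z‖ = ‖y‖ := by
    rw [ht]; field_simp; ring
  set e : EuclideanSpace ℝ (Fin n) := EuclideanSpace.single ⟨0, hn⟩ 1
  have he : ∀ r : ℝ, 0 ≤ r → ‖r • e‖ = r := fun r hr => by
    simp [norm_smul, e, abs_of_nonneg hr]
  have h1 := h.logConcave (‖x‖ • e) (‖z‖ • e) t ht0 ht1
  rw [smul_smul, smul_smul, ← add_smul, hty, h.radial _ x (he _ (norm_nonneg x)),
    h.radial _ z (he _ (norm_nonneg z)), h.radial _ y (he _ (norm_nonneg y))] at h1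
  refine le_trans (le_of_eq ?_) ((mul_le_mul
    (Real.rpow_le_rpow (expDensity_pos hn hβ x).le hx (by linarith))
    (Real.rpow_le_rpow (expDensity_pos hn hβ z).le hz ht0.le)
    (Real.rpow_nonneg (expDensity_pos hn hβ z).le _) (Real.rpow_nonneg (h.nonneg x) _)).trans h1)
  simp only [expDensity]
  set A := β ^ n / (∫ y : EuclideanSpace ℝ (Fin n), Real.exp (-‖y‖))
  have hA : 0 < A := div_pos (by positivity) (integral_exp_neg_norm_pos hn)
  rw [Real.mul_rpow hA.le (Real.exp_pos _).le, Real.mul_rpow hA.le (Real.exp_pos _).le,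
    ← Real.exp_mul, ← Real.exp_mul, mul_mul_mul_comm, ← Real.rpow_add hA, sub_add_cancel,
    Real.rpow_one, ← Real.exp_add, ← hty]
  congr 2
  ring

/-- A radial log-concave density is dominated, in the convex order of squared norms, by the
exponential density with the same second moment. -/
lemma integral_convex_le (hn : 1 ≤ n) (h : IsRadialLogConcaveDensity D) {β : ℝ} (hβ : 0 < β)
    (hm : ∫ x, ‖x‖ ^ 2 * D x = expMean n (fun r => r ^ 2) / β ^ 2)
    {k : ℝ → ℝ} (hk : ConvexOn ℝ (Set.Ici 0) k) {A₀ B₀ : ℝ}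
    (hlow : ∀ u, 0 ≤ u → A₀ + B₀ * u ≤ k u) (hkm : Measurable k)
    (hkp : Integrable fun x : EuclideanSpace ℝ (Fin n) => k (‖x‖ ^ 2) * expDensity β x) :
    Integrable (fun x => k (‖x‖ ^ 2) * D x) ∧
      ∫ x, k (‖x‖ ^ 2) * D x ≤
        ∫ x : EuclideanSpace ℝ (Fin n), k (‖x‖ ^ 2) * expDensity β x := by
  have : Nonempty (Fin n) := ⟨⟨0, hn⟩⟩
  refine integral_convex_comp_le (q := fun x => ‖x‖ ^ 2) (fun x => by positivity) h.nonneg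
    h.integrable (integrable_expDensity hn hβ) (h.integrable_sq_norm_mul hn)
    (integrable_sq_norm_mul_expDensity hn hβ)
    (by rw [h.integral_eq_one, integral_expDensity hn hβ])
    (by rw [hm, integral_sq_norm_mul_expDensity hβ]) (fun c => ?_)
    (fun x y z => h.expDensity_le_of_between hn hβ) hk hlow
    (hkm.comp (by fun_prop)).aestronglyMeasurable hkp
  refine measure_mono_null (t := Metric.sphere 0 √c) (fun x hx => ?_)
    (Measure.addHaar_sphere volume 0 √c)
  have hx : ‖x‖ ^ 2 = c := hx
  simp [← hx]

/-- The convex comparison with `k = sphereCosh σ e ‖ξ‖`. -/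
lemma lintegral_exp_inner_le (hn : 1 ≤ n) (h : IsRadialLogConcaveDensity D) {β : ℝ} (hβ : 0 < β)
    (hm : ∫ x, ‖x‖ ^ 2 * D x = expMean n (fun r => r ^ 2) / β ^ 2)
    {ξ : EuclideanSpace ℝ (Fin n)} (hξ : ‖ξ‖ < β) :
    ∫⁻ x, ENNReal.ofReal (Real.exp ⟪x, ξ⟫) * ENNReal.ofReal (D x) ≤
      ENNReal.ofReal ((1 - (‖ξ‖ / β) ^ 2) ^ (-(((n : ℝ) + 1) / 2))) := by
  obtain ⟨σ, hσp, hσr, hσ⟩ := exists_rotationInvariant_sphere hn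
  set e : EuclideanSpace ℝ (Fin n) := EuclideanSpace.single ⟨0, hn⟩ 1
  have he : ‖e‖ = 1 := by simp [e]
  have hkm := measurable_sphereCosh σ e ‖ξ‖
  have hkm' : Measurable fun x : EuclideanSpace ℝ (Fin n) => sphereCosh σ e ‖ξ‖ (‖x‖ ^ 2) :=
    hkm.comp (by fun_prop)
  have key : ∀ f : EuclideanSpace ℝ (Fin n) → ℝ, Measurable f → (∀ x, 0 ≤ f x) →
      (∀ x y, ‖x‖ = ‖y‖ → f x = f y) →
      Integrable (fun x => sphereCosh σ e ‖ξ‖ (‖x‖ ^ 2) * f x) →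
      ∫⁻ x, ENNReal.ofReal (Real.exp ⟪x, ξ⟫) * ENNReal.ofReal (f x) =
        ENNReal.ofReal (∫ x, sphereCosh σ e ‖ξ‖ (‖x‖ ^ 2) * f x) := by
    intro f hfm hf0 hfr hfi
    have hν := IsRotationInvariant.withDensity_volume hfm.ennreal_ofReal
      (fun x y hxy => by rw [hfr x y hxy])
    have h1 := hν.lintegral_exp_inner_eq hσr hσ he ξ
    rw [lintegral_withDensity_eq_lintegral_mul _ hfm.ennreal_ofReal (by fun_prop),
      lintegral_withDensity_eq_lintegral_mul _ hfm.ennreal_ofReal hkm'.ennreal_ofReal] at h1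
    simp only [Pi.mul_apply] at h1
    simp_rw [mul_comm (ENNReal.ofReal (Real.exp _))]
    rw [h1, ofReal_integral_eq_lintegral_ofReal hfi
      (ae_of_all _ fun x => mul_nonneg (sphereCosh_nonneg _ _) (hf0 x))]
    refine lintegral_congr fun x => ?_
    rw [mul_comm, ENNReal.ofReal_mul (sphereCosh_nonneg _ _)]
  have hip : Integrable fun x : EuclideanSpace ℝ (Fin n) =>
      sphereCosh σ e ‖ξ‖ (‖x‖ ^ 2) * expDensity β x := by
    refine ((integrable_exp_neg_mul_norm hn (sub_pos.2 hξ)).const_mul (β ^ n /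
      (∫ y : EuclideanSpace ℝ (Fin n), Real.exp (-‖y‖)))).mono'
      (hkm'.mul (measurable_expDensity β)).aestronglyMeasurable (ae_of_all _ fun x => ?_)
    rw [Real.norm_of_nonneg (mul_nonneg (sphereCosh_nonneg _ _) (expDensity_pos hn hβ x).le)]
    have h1 := sphereCosh_le hσ he (norm_nonneg ξ) (‖x‖ ^ 2)
    rw [Real.sqrt_sq (norm_nonneg x)] at h1
    refine (mul_le_mul_of_nonneg_right h1 (expDensity_pos hn hβ x).le).trans (le_of_eq ?_)
    rw [expDensity, mul_left_comm, ← Real.exp_add]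
    congr 2
    ring
  obtain ⟨hiD, hle⟩ := h.integral_convex_le hn hβ hm (convexOn_sphereCosh hσ he (norm_nonneg ξ))
    (A₀ := 0) (B₀ := 0) (fun u _ => by simpa using sphereCosh_nonneg (σ := σ) (e := e) ‖ξ‖ u)
    hkm hip
  rw [key D h.measurable h.nonneg h.radial hiD, ← lintegral_exp_inner_mul_expDensity hn hβ hξ,
    key _ (measurable_expDensity β) (fun x => (expDensity_pos hn hβ x).le)
      (fun x y hxy => by simp [expDensity, hxy]) hip]
  exact ENNReal.ofReal_le_ofReal hle

/-- The convex comparison with `k u = -radCramer N (β√u)`. -/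
lemma expMean_radCramer_le (hn : 1 ≤ n) (h : IsRadialLogConcaveDensity D) {β : ℝ} (hβ : 0 < β)
    (hm : ∫ x, ‖x‖ ^ 2 * D x = expMean n (fun r => r ^ 2) / β ^ 2) {N : ℝ} (hN : 0 < N) :
    ENNReal.ofReal (expMean n (radCramer N)) ≤
      ∫⁻ x, ENNReal.ofReal (radCramer N (β * ‖x‖)) * ENNReal.ofReal (D x) := by
  have hG := continuous_radCramer hN
  have hlow : ∀ u : ℝ, 0 ≤ u → -β + -β * u ≤ -radCramer N (β * √u) := fun u hu => by
    linarith [radCramer_mul_sqrt_le hN hβ hu]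
  have hip : Integrable fun x : EuclideanSpace ℝ (Fin n) =>
      -radCramer N (β * √(‖x‖ ^ 2)) * expDensity β x := by
    simpa using (integrable_radCramer_mul_expDensity hn hβ hN).neg
  obtain ⟨hiD, hle⟩ := h.integral_convex_le hn hβ hm (convexOn_neg_radCramer_sqrt hN β) hlow
    (by fun_prop) hip
  simp only [Real.sqrt_sq (norm_nonneg _), neg_mul, integral_neg, neg_le_neg_iff] at hiD hle
  rw [integral_mul_expDensity hβ] at hle
  refine (ENNReal.ofReal_le_ofReal hle).trans (le_of_eq ?_)
  have hiD' : Integrable fun x => radCramer N (β * ‖x‖) * D x := by simpa using hiD.neg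
  rw [ofReal_integral_eq_lintegral_ofReal hiD'
    (ae_of_all _ fun x => mul_nonneg (radCramer_nonneg hN _) (h.nonneg x))]
  exact lintegral_congr fun x => ENNReal.ofReal_mul (radCramer_nonneg hN _)

end IsRadialLogConcaveDensity

/-! ### Smoothing by the uniform law on a ball -/

/-- The density of the convolution of `μ` with the uniform distribution on a ball of
radius `ε`. -/
noncomputable def ballDensity (μ : Measure (EuclideanSpace ℝ (Fin n))) (ε : ℝ)
    (x : EuclideanSpace ℝ (Fin n)) : ℝ :=
  μ.real (Metric.closedBall x ε) /
    volume.real (Metric.closedBall (0 : EuclideanSpace ℝ (Fin n)) ε)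

section smoothing

variable {μ : Measure (EuclideanSpace ℝ (Fin n))} [IsProbabilityMeasure μ] {ε : ℝ}

lemma measurable_measure_closedBall (μ : Measure (EuclideanSpace ℝ (Fin n)))
    [IsProbabilityMeasure μ] (ε : ℝ) : Measurable fun x => μ (Metric.closedBall x ε) := by
  have hs : MeasurableSet {z : EuclideanSpace ℝ (Fin n) × EuclideanSpace ℝ (Fin n) |
      dist z.2 z.1 ≤ ε} := measurableSet_le (by fun_prop) (by fun_prop)
  exact measurable_measure_prodMk_left hs

/-- Tonelli on the symmetric relation `dist x z ≤ ε`: integrating against the smoothed density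
amounts to averaging over balls and then integrating against `μ`. -/
lemma lintegral_mul_ballDensity (hε : 0 < ε) {F : EuclideanSpace ℝ (Fin n) → ℝ≥0∞}
    (hF : Measurable F) :
    ∫⁻ x, F x * ENNReal.ofReal (ballDensity μ ε x) =
      ∫⁻ z, (volume (Metric.closedBall z ε))⁻¹ * (∫⁻ x in Metric.closedBall z ε, F x) ∂μ := by
  set V := volume (Metric.closedBall (0 : EuclideanSpace ℝ (Fin n)) ε) with hV
  have hV0 : V ≠ 0 := (Metric.measure_closedBall_pos _ _ hε).ne'
  have hVt : V ≠ ∞ := measure_closedBall_lt_top.ne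
  have hs : MeasurableSet {z : EuclideanSpace ℝ (Fin n) × EuclideanSpace ℝ (Fin n) |
      dist z.2 z.1 ≤ ε} := measurableSet_le (by fun_prop) (by fun_prop)
  have hD : ∀ x, ENNReal.ofReal (ballDensity μ ε x) = V⁻¹ * μ (Metric.closedBall x ε) := by
    intro x
    rw [ballDensity, ENNReal.ofReal_div_of_pos
      (y := volume.real (Metric.closedBall (0 : EuclideanSpace ℝ (Fin n)) ε))
      (ENNReal.toReal_pos hV0 hVt), ofReal_measureReal, ofReal_measureReal, ENNReal.div_eq_inv_mul]
  have hVz : ∀ z : EuclideanSpace ℝ (Fin n), volume (Metric.closedBall z ε) = V := fun z =>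
    Measure.addHaar_closedBall_center volume z ε
  have hFD : ∀ x, F x * ENNReal.ofReal (ballDensity μ ε x) =
      V⁻¹ * (F x * μ (Metric.closedBall x ε)) := fun x => by rw [hD, mul_left_comm]
  simp_rw [hFD, hVz]
  have hV' : V⁻¹ ≠ ∞ := ENNReal.inv_ne_top.2 hV0
  rw [lintegral_const_mul' _ _ hV', lintegral_const_mul' _ _ hV']
  congr 1
  have hind : Measurable fun z : EuclideanSpace ℝ (Fin n) × EuclideanSpace ℝ (Fin n) =>
      F z.1 * {z : EuclideanSpace ℝ (Fin n) × EuclideanSpace ℝ (Fin n) |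
        dist z.2 z.1 ≤ ε}.indicator (fun _ => (1 : ℝ≥0∞)) z :=
    (hF.comp measurable_fst).mul (measurable_const.indicator hs)
  calc ∫⁻ x, F x * μ (Metric.closedBall x ε)
      = ∫⁻ x, ∫⁻ z, F x * {z : EuclideanSpace ℝ (Fin n) × EuclideanSpace ℝ (Fin n) |
        dist z.2 z.1 ≤ ε}.indicator (fun _ => (1 : ℝ≥0∞)) (x, z) ∂μ := by
        refine lintegral_congr fun x => ?_
        have hx : Measurable fun z : EuclideanSpace ℝ (Fin n) =>
            {z : EuclideanSpace ℝ (Fin n) × EuclideanSpace ℝ (Fin n) |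
              dist z.2 z.1 ≤ ε}.indicator (fun _ => (1 : ℝ≥0∞)) (x, z) :=
          (measurable_const.indicator hs).comp measurable_prodMk_left
        rw [lintegral_const_mul _ hx,
          ← lintegral_indicator_one Metric.isClosed_closedBall.measurableSet]
        rfl
    _ = ∫⁻ z, (∫⁻ x, F x * {z : EuclideanSpace ℝ (Fin n) × EuclideanSpace ℝ (Fin n) |
        dist z.2 z.1 ≤ ε}.indicator (fun _ => (1 : ℝ≥0∞)) (x, z)) ∂μ :=
        lintegral_lintegral_swap hind.aemeasurable
    _ = _ := by
        refine lintegral_congr fun z => ?_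
        rw [← lintegral_indicator Metric.isClosed_closedBall.measurableSet]
        refine lintegral_congr fun x => ?_
        by_cases hx : dist x z ≤ ε
        · simp [hx, dist_comm z x]
        · simp [hx, dist_comm z x]

lemma lintegral_mul_ballDensity_le (hε : 0 < ε) {F Φ : EuclideanSpace ℝ (Fin n) → ℝ≥0∞}
    (hF : Measurable F) (h : ∀ x z, dist x z ≤ ε → F x ≤ Φ z) :
    ∫⁻ x, F x * ENNReal.ofReal (ballDensity μ ε x) ≤ ∫⁻ z, Φ z ∂μ := by
  rw [lintegral_mul_ballDensity hε hF]
  refine lintegral_mono fun z => ?_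
  calc (volume (Metric.closedBall z ε))⁻¹ * (∫⁻ x in Metric.closedBall z ε, F x)
      ≤ (volume (Metric.closedBall z ε))⁻¹ * (∫⁻ _ in Metric.closedBall z ε, Φ z) := by
        gcongr 1
        exact setLIntegral_mono' Metric.isClosed_closedBall.measurableSet fun x hx => h x z hx
    _ = Φ z := by
        rw [setLIntegral_const, mul_left_comm, ENNReal.inv_mul_cancel
          (Metric.measure_closedBall_pos _ _ hε).ne' measure_closedBall_lt_top.ne, mul_one]

lemma le_lintegral_mul_ballDensity (hε : 0 < ε) {F Φ : EuclideanSpace ℝ (Fin n) → ℝ≥0∞}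
    (hF : Measurable F) (h : ∀ x z, dist x z ≤ ε → Φ z ≤ F x) :
    ∫⁻ z, Φ z ∂μ ≤ ∫⁻ x, F x * ENNReal.ofReal (ballDensity μ ε x) := by
  rw [lintegral_mul_ballDensity hε hF]
  refine lintegral_mono fun z => ?_
  calc Φ z = (volume (Metric.closedBall z ε))⁻¹ * (∫⁻ _ in Metric.closedBall z ε, Φ z) := by
        rw [setLIntegral_const, mul_left_comm, ENNReal.inv_mul_cancel
          (Metric.measure_closedBall_pos _ _ hε).ne' measure_closedBall_lt_top.ne, mul_one]
    _ ≤ _ := by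
        gcongr 1
        exact setLIntegral_mono' Metric.isClosed_closedBall.measurableSet fun x hx => h x z hx

lemma isRadialLogConcaveDensity_ballDensity (hlc : IsLogConcaveMeasure μ)
    (hrot : IsRotationInvariant μ) (hε : 0 < ε) :
    IsRadialLogConcaveDensity (ballDensity μ ε) where
  measurable := ((measurable_measure_closedBall μ ε).ennreal_toReal).div_const _
  nonneg x := by unfold ballDensity; positivity
  lintegral_eq_one := by
    have h1 := lintegral_mul_ballDensity_le (μ := μ) hε (F := fun _ => 1) (Φ := fun _ => 1)
      measurable_const fun _ _ _ => le_rfl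
    have h2 := le_lintegral_mul_ballDensity (μ := μ) hε (F := fun _ => 1) (Φ := fun _ => 1)
      measurable_const fun _ _ _ => le_rfl
    simp only [one_mul, lintegral_one, measure_univ] at h1 h2
    exact le_antisymm h1 h2
  radial x y hxy := by
    obtain ⟨U, rfl⟩ := exists_linearIsometryEquiv_apply_eq hxy
    have h : μ (Metric.closedBall (U x) ε) = μ (Metric.closedBall x ε) := by
      conv_lhs => rw [← hrot U]
      rw [Measure.map_apply U.continuous.measurable Metric.isClosed_closedBall.measurableSet]
      congr 1
      ext z
      simp
    simp [ballDensity, measureReal_def, h]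
  logConcave x y t ht0 ht1 := by
    set V := volume.real (Metric.closedBall (0 : EuclideanSpace ℝ (Fin n)) ε)
    have hV : 0 < V := ENNReal.toReal_pos (Metric.measure_closedBall_pos _ _ hε).ne'
      measure_closedBall_lt_top.ne
    -- Convex combinations of two balls of radius `ε` stay in the ball of radius `ε` about the
    -- combined centre, so log-concavity of `μ` on balls becomes pointwise log-concavity of the
    -- density.
    have hsub : (1 - t) • Metric.closedBall x ε + t • Metric.closedBall y ε ⊆
        Metric.closedBall ((1 - t) • x + t • y) ε := by
      rintro _ ⟨_, ⟨a, ha, rfl⟩, _, ⟨b, hb, rfl⟩, rfl⟩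
      rw [mem_closedBall_iff_norm] at ha hb ⊢
      have e : (1 - t) • a + t • b - ((1 - t) • x + t • y) = (1 - t) • (a - x) + t • (b - y) := by
        module
      simp only [e]
      refine (norm_add_le _ _).trans ?_
      rw [norm_smul, norm_smul, Real.norm_of_nonneg ht0.le, Real.norm_of_nonneg (by linarith)]
      nlinarith
    have h1 := (hlc _ _ Metric.isClosed_closedBall.measurableSet
      Metric.isClosed_closedBall.measurableSet t ht0 ht1).trans (measure_mono hsub)
    have h2 := ENNReal.toReal_mono (measure_ne_top _ _) h1
    rw [ENNReal.toReal_mul, ← ENNReal.toReal_rpow, ← ENNReal.toReal_rpow] at h2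
    simp only [ballDensity]
    rw [Real.div_rpow measureReal_nonneg hV.le, Real.div_rpow measureReal_nonneg hV.le,
      div_mul_div_comm, ← Real.rpow_add hV, sub_add_cancel, Real.rpow_one]
    exact div_le_div_of_nonneg_right h2 hV.le

lemma sq_norm_le_of_dist_le {x z : EuclideanSpace ℝ (Fin n)} (hε : 0 < ε) (h : dist x z ≤ ε) :
    ‖x‖ ^ 2 ≤ (1 + ε) * ‖z‖ ^ 2 + (ε + ε ^ 2) := by
  have h1 : ‖x‖ ≤ ‖z‖ + ε := by
    rw [dist_eq_norm] at h
    linarith [norm_le_norm_add_norm_sub z x, norm_sub_rev x z]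
  nlinarith [norm_nonneg x, norm_nonneg z, mul_nonneg hε.le (sq_nonneg (‖z‖ - 1))]

/-- The convolution with the unit ball has an exponentially decaying density, and moving points by
at most one changes `‖x‖²` by a controlled amount. -/
lemma integrable_sq_norm_of_logConcave (hn : 1 ≤ n) (hlc : IsLogConcaveMeasure μ)
    (hrot : IsRotationInvariant μ) : Integrable (fun x => ‖x‖ ^ 2) μ := by
  have hD := isRadialLogConcaveDensity_ballDensity hlc hrot one_pos
  refine ⟨by fun_prop, ?_⟩
  rw [hasFiniteIntegral_iff_ofReal (ae_of_all _ fun _ => by positivity)]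
  refine (le_lintegral_mul_ballDensity one_pos
    (F := fun x => ENNReal.ofReal ((1 + 1) * ‖x‖ ^ 2 + (1 + 1 ^ 2))) (by fun_prop) fun x z h =>
    ENNReal.ofReal_le_ofReal (sq_norm_le_of_dist_le one_pos (dist_comm x z ▸ h))).trans_lt ?_
  have hi : Integrable fun x => ((1 + 1) * ‖x‖ ^ 2 + (1 + 1 ^ 2)) * ballDensity μ 1 x :=
    (((hD.integrable_sq_norm_mul hn).const_mul 2).add (hD.integrable.const_mul 2)).congr
      (ae_of_all _ fun x => by simp only [Pi.add_apply]; ring)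
  have := hi.lintegral_lt_top
  refine lt_of_eq_of_lt (lintegral_congr fun x => ?_) this
  rw [ENNReal.ofReal_mul (by positivity)]

/-- A vanishing second moment would put all mass at the origin, hence on a hyperplane through it. -/
lemma integral_sq_norm_pos (hn : 1 ≤ n) (hnd : IsNondegenerate μ)
    (hi : Integrable (fun x => ‖x‖ ^ 2) μ) : 0 < ∫ x, ‖x‖ ^ 2 ∂μ := by
  refine lt_of_le_of_ne (integral_nonneg fun x => by positivity) fun h0 => ?_
  have h1 := (integral_eq_zero_iff_of_nonneg (fun x => by positivity) hi).1 h0.symm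
  set e : EuclideanSpace ℝ (Fin n) := EuclideanSpace.single ⟨0, hn⟩ 1
  have he : e ≠ 0 := by simp [e]
  refine (hnd e he 0).ne ?_
  refine (mem_ae_iff_prob_eq_one (measurableSet_eq_fun (by fun_prop) (by fun_prop))).1 ?_
  filter_upwards [h1] with x hx
  have hx : x = 0 := by simpa using hx
  simp [hx]

lemma tendsto_integral_sq_norm_mul_ballDensity (hn : 1 ≤ n) (hlc : IsLogConcaveMeasure μ)
    (hrot : IsRotationInvariant μ) :
    Filter.Tendsto (fun ε => ∫ x, ‖x‖ ^ 2 * ballDensity μ ε x) (nhdsWithin 0 (Set.Ioi 0))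
      (nhds (∫ x, ‖x‖ ^ 2 ∂μ)) := by
  have hi := integrable_sq_norm_of_logConcave hn hlc hrot
  set m := ∫ x, ‖x‖ ^ 2 ∂μ with hm
  have hm0 : 0 ≤ m := integral_nonneg fun x => by positivity
  have hl : ∀ a b : ℝ, 0 ≤ a → 0 ≤ b → ∫⁻ z, ENNReal.ofReal (a * ‖z‖ ^ 2 + b) ∂μ =
      ENNReal.ofReal (a * m + b) := fun a b ha hb => by
    have hab : Integrable (fun x => a * ‖x‖ ^ 2 + b) μ :=
      (hi.const_mul a).add (integrable_const b)
    rw [← ofReal_integral_eq_lintegral_ofReal hab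
      (ae_of_all _ fun x => by simp only [Pi.zero_apply]; positivity)]
    congr 1
    rw [integral_add (hi.const_mul a) (integrable_const b), integral_const_mul, ← hm]
    simp
  have hD : ∀ ε, 0 < ε → ∀ a b : ℝ, 0 ≤ a → 0 ≤ b →
      ∫⁻ x, ENNReal.ofReal (a * ‖x‖ ^ 2 + b) * ENNReal.ofReal (ballDensity μ ε x) =
      ENNReal.ofReal (a * (∫ x, ‖x‖ ^ 2 * ballDensity μ ε x) + b) := fun ε hε a b ha hb => by
    have hD := isRadialLogConcaveDensity_ballDensity hlc hrot hε
    have h1 := ((hD.integrable_sq_norm_mul hn).const_mul a).add (hD.integrable.const_mul b)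
    have h2 : ∫ x, (a * (‖x‖ ^ 2 * ballDensity μ ε x) + b * ballDensity μ ε x) =
        a * (∫ x, ‖x‖ ^ 2 * ballDensity μ ε x) + b := by
      rw [integral_add ((hD.integrable_sq_norm_mul hn).const_mul a) (hD.integrable.const_mul b),
        integral_const_mul, integral_const_mul, hD.integral_eq_one, mul_one]
    rw [← h2]
    refine Eq.trans (lintegral_congr fun x => ?_) (ofReal_integral_eq_lintegral_ofReal h1
      (ae_of_all _ fun x => ?_)).symm
    · rw [← ENNReal.ofReal_mul (by positivity)]
      congr 1
      simp only [Pi.add_apply]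
      ring
    · have := hD.nonneg x
      simp only [Pi.add_apply, Pi.zero_apply]
      positivity
  have hup : ∀ ε, 0 < ε → ∫ x, ‖x‖ ^ 2 * ballDensity μ ε x ≤ (1 + ε) * m + (ε + ε ^ 2) := by
    intro ε hε
    have h := lintegral_mul_ballDensity_le (μ := μ) hε
      (F := fun x => ENNReal.ofReal (1 * ‖x‖ ^ 2 + 0))
      (Φ := fun z => ENNReal.ofReal ((1 + ε) * ‖z‖ ^ 2 + (ε + ε ^ 2))) (by fun_prop)
      fun x z h => ENNReal.ofReal_le_ofReal (by simpa using sq_norm_le_of_dist_le hε h)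
    rw [hl _ _ (by positivity) (by positivity), hD ε hε 1 0 zero_le_one le_rfl,
      ENNReal.ofReal_le_ofReal_iff (by positivity)] at h
    linarith
  have hlo : ∀ ε, 0 < ε → (m - (ε + ε ^ 2)) / (1 + ε) ≤ ∫ x, ‖x‖ ^ 2 * ballDensity μ ε x := by
    intro ε hε
    have h := le_lintegral_mul_ballDensity (μ := μ) hε
      (Φ := fun x => ENNReal.ofReal (1 * ‖x‖ ^ 2 + 0))
      (F := fun z => ENNReal.ofReal ((1 + ε) * ‖z‖ ^ 2 + (ε + ε ^ 2))) (by fun_prop)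
      fun x z h => ENNReal.ofReal_le_ofReal
        (by simpa using sq_norm_le_of_dist_le hε (dist_comm x z ▸ h))
    have h0 : 0 ≤ ∫ x, ‖x‖ ^ 2 * ballDensity μ ε x := integral_nonneg fun x =>
      mul_nonneg (by positivity) ((isRadialLogConcaveDensity_ballDensity hlc hrot hε).nonneg x)
    rw [hl 1 0 zero_le_one le_rfl, hD ε hε _ _ (by positivity) (by positivity),
      ENNReal.ofReal_le_ofReal_iff (by positivity)] at h
    rw [div_le_iff₀ (by positivity)]
    linarith
  have t1 : Filter.Tendsto (fun ε : ℝ => (m - (ε + ε ^ 2)) / (1 + ε)) (nhdsWithin 0 (Set.Ioi 0))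
      (nhds m) := by
    have : ContinuousAt (fun ε : ℝ => (m - (ε + ε ^ 2)) / (1 + ε)) 0 :=
      ContinuousAt.div (by fun_prop) (by fun_prop) (by norm_num)
    have := this.tendsto
    simp only [ne_eq, OfNat.ofNat_ne_zero, not_false_eq_true, zero_pow, add_zero, sub_zero,
      div_one] at this
    exact this.mono_left nhdsWithin_le_nhds
  have t2 : Filter.Tendsto (fun ε : ℝ => (1 + ε) * m + (ε + ε ^ 2)) (nhdsWithin 0 (Set.Ioi 0))
      (nhds m) := by
    have : Continuous (fun ε : ℝ => (1 + ε) * m + (ε + ε ^ 2)) := by fun_prop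
    have := this.tendsto 0
    simp only [ne_eq, OfNat.ofNat_ne_zero, not_false_eq_true, zero_pow, add_zero, one_mul] at this
    exact this.mono_left nhdsWithin_le_nhds
  refine tendsto_of_tendsto_of_tendsto_of_le_of_le' t1 t2 ?_ ?_
  · filter_upwards [self_mem_nhdsWithin] with ε hε using hlo ε hε
  · filter_upwards [self_mem_nhdsWithin] with ε hε using hup ε hε

end smoothing

/-! ### Removing the smoothing -/

open Filter Topology in
/-- Comparison of a rotation invariant log-concave law with the radial exponential law of the
same second moment. -/
lemma exists_exp_comparison (hn : 1 ≤ n) {μ : Measure (EuclideanSpace ℝ (Fin n))}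
    [IsProbabilityMeasure μ] (hlc : IsLogConcaveMeasure μ) (hrot : IsRotationInvariant μ)
    (hnd : IsNondegenerate μ) :
    ∃ β : ℝ, 0 < β ∧
      (∀ ξ : EuclideanSpace ℝ (Fin n), ‖ξ‖ < β → ∫⁻ x, ENNReal.ofReal (Real.exp ⟪x, ξ⟫) ∂μ ≤
        ENNReal.ofReal ((1 - (‖ξ‖ / β) ^ 2) ^ (-(((n : ℝ) + 1) / 2)))) ∧
      ∀ N : ℝ, 0 < N → ENNReal.ofReal (expMean n (radCramer N)) ≤
        ∫⁻ x, ENNReal.ofReal (radCramer N (β * ‖x‖)) ∂μ := by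
  have hi := integrable_sq_norm_of_logConcave hn hlc hrot
  have hm0 := integral_sq_norm_pos hn hnd hi
  have hlim := tendsto_integral_sq_norm_mul_ballDensity hn hlc hrot
  set m := ∫ x, ‖x‖ ^ 2 ∂μ
  set κ := expMean n (fun r => r ^ 2) with hκ
  have hκ0 : 0 < κ := expMean_sq_pos hn
  set M : ℝ → ℝ := fun ε => ∫ x, ‖x‖ ^ 2 * ballDensity μ ε x
  -- The rate for which the exponential density has the second moment `M ε` of the smoothed law; it
  -- converges to `β`.
  set b : ℝ → ℝ := fun ε => √(κ / M ε)
  set β := √(κ / m)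
  have hβ : 0 < β := by positivity
  have hblim : Tendsto b (𝓝[>] 0) (𝓝 β) :=
    (Real.continuous_sqrt.tendsto _).comp (tendsto_const_nhds.div hlim hm0.ne')
  have hev : ∀ᶠ ε in 𝓝[>] (0 : ℝ), 0 < ε ∧ 0 < b ε ∧ M ε = κ / b ε ^ 2 := by
    filter_upwards [self_mem_nhdsWithin, hlim.eventually (lt_mem_nhds hm0)] with ε hε hM
    have hM : 0 < M ε := hM
    refine ⟨hε, by positivity, ?_⟩
    rw [Real.sq_sqrt (by positivity)]
    field_simp
  have hid : Tendsto (fun ε : ℝ => ε) (𝓝[>] 0) (𝓝 0) :=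
    tendsto_id.mono_left nhdsWithin_le_nhds
  refine ⟨β, hβ, fun ξ hξ => ?_, fun N hN => ?_⟩
  · have hpos : 0 < 1 - (‖ξ‖ / β) ^ 2 := by
      have : ‖ξ‖ / β < 1 := (div_lt_one hβ).2 hξ
      have : 0 ≤ ‖ξ‖ / β := by positivity
      nlinarith
    -- Replacing `μ` by its smoothing costs at most a factor `exp (ε‖ξ‖)` in the Laplace transform.
    have ht : Tendsto (fun ε => ENNReal.ofReal (Real.exp (ε * ‖ξ‖) *
        (1 - (‖ξ‖ / b ε) ^ 2) ^ (-(((n : ℝ) + 1) / 2)))) (𝓝[>] 0)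
        (𝓝 (ENNReal.ofReal (Real.exp (0 * ‖ξ‖) *
          (1 - (‖ξ‖ / β) ^ 2) ^ (-(((n : ℝ) + 1) / 2))))) := by
      refine ENNReal.tendsto_ofReal (Tendsto.mul ?_ ?_)
      · exact (Real.continuous_exp.tendsto _).comp (hid.mul_const _)
      · exact ((tendsto_const_nhds.sub ((tendsto_const_nhds.div hblim hβ.ne').pow 2))).rpow_const
          (Or.inl hpos.ne')
    rw [zero_mul, Real.exp_zero, one_mul] at ht
    refine ge_of_tendsto ht ?_
    filter_upwards [hev, hblim.eventually (lt_mem_nhds hξ)] with ε ⟨hε, hb, hM⟩ hξb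
    have hD := isRadialLogConcaveDensity_ballDensity hlc hrot hε
    calc ∫⁻ z, ENNReal.ofReal (Real.exp ⟪z, ξ⟫) ∂μ
        ≤ ∫⁻ x, (ENNReal.ofReal (Real.exp (ε * ‖ξ‖)) * ENNReal.ofReal (Real.exp ⟪x, ξ⟫)) *
            ENNReal.ofReal (ballDensity μ ε x) := by
          refine le_lintegral_mul_ballDensity hε (by fun_prop) fun x z h => ?_
          rw [← ENNReal.ofReal_mul (Real.exp_pos _).le, ← Real.exp_add]
          refine ENNReal.ofReal_le_ofReal (Real.exp_le_exp.2 ?_)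
          have h1 : ⟪z - x, ξ⟫ ≤ ε * ‖ξ‖ := (real_inner_le_norm _ _).trans
            (mul_le_mul_of_nonneg_right (by rwa [← dist_eq_norm, dist_comm]) (norm_nonneg _))
          rw [inner_sub_left] at h1
          linarith
      _ = ENNReal.ofReal (Real.exp (ε * ‖ξ‖)) * ∫⁻ x, ENNReal.ofReal (Real.exp ⟪x, ξ⟫) *
            ENNReal.ofReal (ballDensity μ ε x) := by
          simp_rw [mul_assoc]
          rw [lintegral_const_mul' _ _ ENNReal.ofReal_ne_top]
      _ ≤ ENNReal.ofReal (Real.exp (ε * ‖ξ‖)) *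
            ENNReal.ofReal ((1 - (‖ξ‖ / b ε) ^ 2) ^ (-(((n : ℝ) + 1) / 2))) := by
          gcongr 1
          exact hD.lintegral_exp_inner_le hn hb hM hξb
      _ = _ := (ENNReal.ofReal_mul (Real.exp_pos _).le).symm
  · have hG := continuous_radCramer hN
    set c := ∫⁻ z, ENNReal.ofReal ‖z‖ ∂μ
    have hc : c ≠ ∞ := by
      have h1 : Integrable (fun x : EuclideanSpace ℝ (Fin n) => 1 + ‖x‖ ^ 2) μ :=
        (integrable_const 1).add hi
      refine (lt_of_le_of_lt (lintegral_mono fun z => ENNReal.ofReal_le_ofReal ?_)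
        h1.lintegral_lt_top).ne
      nlinarith [sq_nonneg (‖z‖ - 1)]
    set I := ∫⁻ z, ENNReal.ofReal (radCramer N (β * ‖z‖)) ∂μ
    -- The Lipschitz bound on `radCramer` splits the error into the change of rate, times the first
    -- moment, and the displacement by at most `ε`.
    have ht : Tendsto (fun ε => I + ENNReal.ofReal |b ε - β| * c + ENNReal.ofReal (b ε * ε))
        (𝓝[>] 0) (𝓝 (I + ENNReal.ofReal |β - β| * c + ENNReal.ofReal (β * 0))) := by
      refine (tendsto_const_nhds.add (ENNReal.Tendsto.mul_const ?_ (Or.inr hc))).add ?_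
      · exact ENNReal.tendsto_ofReal (hblim.sub_const β).abs
      · exact ENNReal.tendsto_ofReal (hblim.mul hid)
    simp only [sub_self, abs_zero, ENNReal.ofReal_zero, zero_mul, mul_zero, add_zero] at ht
    refine ge_of_tendsto ht ?_
    filter_upwards [hev] with ε ⟨hε, hb, hM⟩
    have hD := isRadialLogConcaveDensity_ballDensity hlc hrot hε
    calc ENNReal.ofReal (expMean n (radCramer N))
        ≤ ∫⁻ x, ENNReal.ofReal (radCramer N (b ε * ‖x‖)) * ENNReal.ofReal (ballDensity μ ε x) :=
          hD.expMean_radCramer_le hn hb hM hN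
      _ ≤ ∫⁻ z, (ENNReal.ofReal (radCramer N (β * ‖z‖)) +
            ENNReal.ofReal |b ε - β| * ENNReal.ofReal ‖z‖ + ENNReal.ofReal (b ε * ε)) ∂μ := by
          refine lintegral_mul_ballDensity_le hε (by fun_prop) fun x z h => ?_
          rw [← ENNReal.ofReal_mul (abs_nonneg _), ← ENNReal.ofReal_add (radCramer_nonneg hN _)
            (by positivity), ← ENNReal.ofReal_add (add_nonneg (radCramer_nonneg hN _)
            (by positivity)) (by positivity)]
          refine ENNReal.ofReal_le_ofReal ((radCramer_le_add_abs hN (by positivity)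
            (β * ‖z‖)).trans ?_)
          rw [add_assoc]
          gcongr
          have h1 : |‖x‖ - ‖z‖| ≤ ε :=
            (abs_norm_sub_norm_le x z).trans (by rwa [← dist_eq_norm])
          have e : b ε * ‖x‖ - β * ‖z‖ = (b ε - β) * ‖z‖ + b ε * (‖x‖ - ‖z‖) := by ring
          rw [e]
          refine (abs_add_le _ _).trans ?_
          rw [abs_mul, abs_mul, abs_norm, abs_of_pos hb]
          gcongr
      _ = I + ENNReal.ofReal |b ε - β| * c + ENNReal.ofReal (b ε * ε) := by
          rw [lintegral_add_right _ measurable_const, lintegral_add_left (by fun_prop),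
            lintegral_const_mul _ (by fun_prop)]
          simp [I, c]

/-! ### Cramér transforms and the conclusion -/

lemma log_ofReal_one_sub_sq_rpow {s N : ℝ} (hs : s ^ 2 < 1) :
    ENNReal.log (ENNReal.ofReal ((1 - s ^ 2) ^ (-N))) =
      ((-(N * Real.log (1 - s ^ 2)) : ℝ) : EReal) := by
  have h : 0 < 1 - s ^ 2 := by linarith
  rw [ENNReal.log_ofReal_of_pos (by positivity), Real.log_rpow h, neg_mul]

lemma radCramer_le_cramerTransform {μ : Measure (EuclideanSpace ℝ (Fin n))}
    {N β : ℝ} (hN : 0 < N) (hβ : 0 < β)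
    (hμ : ∀ ξ : EuclideanSpace ℝ (Fin n), ‖ξ‖ < β → ∫⁻ x, ENNReal.ofReal (Real.exp ⟪x, ξ⟫) ∂μ ≤
      ENNReal.ofReal ((1 - (‖ξ‖ / β) ^ 2) ^ (-N))) (x : EuclideanSpace ℝ (Fin n)) :
    ((radCramer N (β * ‖x‖) : ℝ) : EReal) ≤ cramerTransform μ x := by
  obtain ⟨s, hs0, hs1, hs⟩ := exists_radCramer_eq hN (by positivity : 0 ≤ β * ‖x‖)
  -- The optimal `ξ` is parallel to `x` with length `sβ`. Only `≤` is claimed because at `x = 0` the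
  -- formula gives `ξ = 0`; this suffices, as `log (1 - s²)` decreases for `s ≥ 0`.
  obtain ⟨ξ, hξn, hξi⟩ : ∃ ξ : EuclideanSpace ℝ (Fin n),
      ‖ξ‖ / β ≤ s ∧ ⟪x, ξ⟫ = s * (β * ‖x‖) := by
    refine ⟨(s * β / ‖x‖) • x, ?_, ?_⟩
    · rw [norm_smul, Real.norm_of_nonneg (by positivity), div_le_iff₀ hβ]
      rcases eq_or_ne ‖x‖ 0 with h0 | h0
      · simp only [h0, mul_zero]; positivity
      · rw [div_mul_cancel₀ _ h0]
    · rw [real_inner_smul_right, real_inner_self_eq_norm_sq]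
      rcases eq_or_ne ‖x‖ 0 with h0 | h0
      · simp [h0]
      · field_simp
  refine le_iSup_of_le ξ ?_
  have hsq : (‖ξ‖ / β) ^ 2 ≤ s ^ 2 := by gcongr
  have h1 : logLaplace μ ξ ≤ ((-(N * Real.log (1 - (‖ξ‖ / β) ^ 2)) : ℝ) : EReal) := by
    rw [← log_ofReal_one_sub_sq_rpow (by nlinarith)]
    exact ENNReal.log_monotone (hμ ξ ((div_lt_one hβ).1 (hξn.trans_lt hs1)))
  refine le_trans ?_ (EReal.sub_le_sub le_rfl h1)
  rw [← EReal.coe_sub, EReal.coe_le_coe_iff, hs, hξi, sub_neg_eq_add]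
  gcongr
  nlinarith

lemma cramerTransform_le_radCramer {μ : Measure (EuclideanSpace ℝ (Fin n))}
    {N β : ℝ} (hN : 0 < N) (hβ : 0 < β)
    (hμ : ∀ ξ : EuclideanSpace ℝ (Fin n), ‖ξ‖ < β → ∫⁻ x, ENNReal.ofReal (Real.exp ⟪x, ξ⟫) ∂μ =
      ENNReal.ofReal ((1 - (‖ξ‖ / β) ^ 2) ^ (-N)))
    (hμ' : ∀ ξ : EuclideanSpace ℝ (Fin n), β ≤ ‖ξ‖ →
      ∫⁻ x, ENNReal.ofReal (Real.exp ⟪x, ξ⟫) ∂μ = ∞) (x : EuclideanSpace ℝ (Fin n)) :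
    cramerTransform μ x ≤ ((radCramer N (β * ‖x‖) : ℝ) : EReal) := by
  refine iSup_le fun ξ => ?_
  rcases lt_or_ge ‖ξ‖ β with h | h
  · have hs : ‖ξ‖ / β < 1 := (div_lt_one hβ).2 h
    have hs0 : 0 ≤ ‖ξ‖ / β := by positivity
    have hs2 : (‖ξ‖ / β) ^ 2 < 1 := by nlinarith
    rw [logLaplace, hμ ξ h, log_ofReal_one_sub_sq_rpow hs2, ← EReal.coe_sub,
      EReal.coe_le_coe_iff, sub_neg_eq_add]
    refine le_trans ?_ (add_mul_log_le_radCramer hN (β * ‖x‖) hs2)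
    have e : ‖ξ‖ / β * (β * ‖x‖) = ‖x‖ * ‖ξ‖ := by field_simp
    rw [e]
    gcongr
    exact real_inner_le_norm x ξ
  · rw [logLaplace, hμ' ξ h, ENNReal.log_top, EReal.sub_top]
    exact bot_le

/-- The constant `c_n` need not be evaluated: total mass one determines it, and the mass is one
because `radialExp n` is the law of a random vector. -/
lemma radialExp_eq_withDensity (hn : 1 ≤ n) (hp : IsProbabilityMeasure (radialExp n)) :
    radialExp n = volume.withDensity fun x => ENNReal.ofReal (expDensity √((n : ℝ) + 1) x) := by
  have hβ : 0 < √((n : ℝ) + 1) := by positivity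
  have h1 : ∫⁻ x : EuclideanSpace ℝ (Fin n), ENNReal.ofReal (radialExpConst n *
      Real.exp (-(√((n : ℝ) + 1) * ‖x‖))) = 1 := by
    have := hp.measure_univ
    rwa [radialExp, withDensity_apply _ MeasurableSet.univ, Measure.restrict_univ] at this
  have hc : 0 ≤ radialExpConst n := by
    by_contra! hc
    have : ∀ x : EuclideanSpace ℝ (Fin n), ENNReal.ofReal (radialExpConst n *
      Real.exp (-(√((n : ℝ) + 1) * ‖x‖))) = 0 := fun x =>
        ENNReal.ofReal_of_nonpos (mul_nonpos_of_nonpos_of_nonneg hc.le (Real.exp_pos _).le)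
    simp [this] at h1
  have hI := integrable_exp_neg_mul_norm hn hβ
  rw [← ofReal_integral_eq_lintegral_ofReal (hI.const_mul _)
    (ae_of_all _ fun x => mul_nonneg hc (Real.exp_pos _).le), ENNReal.ofReal_eq_one,
    integral_const_mul] at h1
  have h2 := integral_expDensity hn hβ
  simp only [expDensity] at h2
  rw [integral_const_mul] at h2
  have h3 := mul_right_cancel₀ (integral_exp_pos hI).ne' (h2.trans h1.symm)
  rw [radialExp, ← h3]
  rfl

lemma lintegral_radialExp (hn : 1 ≤ n) (hp : IsProbabilityMeasure (radialExp n))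
    {f : EuclideanSpace ℝ (Fin n) → ℝ≥0∞} (hf : Measurable f) :
    ∫⁻ x, f x ∂(radialExp n) = ∫⁻ x, f x * ENNReal.ofReal (expDensity √((n : ℝ) + 1) x) := by
  rw [radialExp_eq_withDensity hn hp, lintegral_withDensity_eq_lintegral_mul _
    (measurable_expDensity _).ennreal_ofReal hf]
  exact lintegral_congr fun x => mul_comm (ENNReal.ofReal (expDensity _ x)) (f x)

lemma lintegral_exp_inner_radialExp (hn : 1 ≤ n) (hp : IsProbabilityMeasure (radialExp n))
    {ξ : EuclideanSpace ℝ (Fin n)} (hξ : ‖ξ‖ < √((n : ℝ) + 1)) :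
    ∫⁻ x, ENNReal.ofReal (Real.exp ⟪x, ξ⟫) ∂(radialExp n) =
      ENNReal.ofReal ((1 - (‖ξ‖ / √((n : ℝ) + 1)) ^ 2) ^ (-(((n : ℝ) + 1) / 2))) := by
  rw [lintegral_radialExp hn hp (by fun_prop),
    lintegral_exp_inner_mul_expDensity hn (by positivity) hξ]

lemma lintegral_exp_inner_radialExp_eq_top (hn : 1 ≤ n)
    (hp : IsProbabilityMeasure (radialExp n))
    {ξ : EuclideanSpace ℝ (Fin n)} (hξ : √((n : ℝ) + 1) ≤ ‖ξ‖) :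
    ∫⁻ x, ENNReal.ofReal (Real.exp ⟪x, ξ⟫) ∂(radialExp n) = ∞ := by
  have hβ : 0 < √((n : ℝ) + 1) := by positivity
  set A := √((n : ℝ) + 1) ^ n / (∫ y : EuclideanSpace ℝ (Fin n), Real.exp (-‖y‖)) with hA
  have hA0 : 0 < A := div_pos (by positivity) (integral_exp_neg_norm_pos hn)
  rw [lintegral_radialExp hn hp (by fun_prop)]
  have h3 : ∀ x : EuclideanSpace ℝ (Fin n),
      ENNReal.ofReal (Real.exp ⟪x, ξ⟫) * ENNReal.ofReal (expDensity √((n : ℝ) + 1) x) =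
      ENNReal.ofReal A * (ENNReal.ofReal (Real.exp ⟪x, ξ⟫) *
        ENNReal.ofReal (Real.exp (-(√((n : ℝ) + 1) * ‖x‖)))) := fun x => by
    rw [expDensity, ENNReal.ofReal_mul hA0.le, mul_left_comm]
  simp_rw [h3]
  rw [lintegral_const_mul _ (by fun_prop), lintegral_exp_inner_mul_exp_neg_norm_eq_top hn hβ hξ]
  exact ENNReal.mul_top (by simpa using hA0)

lemma lintegral_radCramer_radialExp (hn : 1 ≤ n) (hp : IsProbabilityMeasure (radialExp n))
    {N : ℝ} (hN : 0 < N) :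
    ∫⁻ x, ENNReal.ofReal (radCramer N (√((n : ℝ) + 1) * ‖x‖)) ∂(radialExp n) =
      ENNReal.ofReal (expMean n (radCramer N)) := by
  have hβ : 0 < √((n : ℝ) + 1) := by positivity
  have hG := continuous_radCramer hN
  rw [lintegral_radialExp hn hp (by fun_prop), ← integral_mul_expDensity hβ,
    ofReal_integral_eq_lintegral_ofReal (integrable_radCramer_mul_expDensity hn hβ hN)
      (ae_of_all _ fun x => mul_nonneg (radCramer_nonneg hN _) (expDensity_pos hn hβ x).le)]
  exact lintegral_congr fun x => (ENNReal.ofReal_mul (radCramer_nonneg hN _)).symm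

theorem theorem3 {n : ℕ} (hn : 1 ≤ n)
    {Ω Ω' : Type*} [MeasurableSpace Ω] [MeasurableSpace Ω']
    (P : Measure Ω) [IsProbabilityMeasure P] (P' : Measure Ω') [IsProbabilityMeasure P']
    (X : Ω → EuclideanSpace ℝ (Fin n)) (hX : AEMeasurable X P)
    (hlc : IsLogConcaveMeasure (P.map X))
    (hrot : IsRotationInvariant (P.map X))
    (hnd : IsNondegenerate (P.map X))
    (Y : Ω' → EuclideanSpace ℝ (Fin n)) (hY : HasLaw Y (radialExp n) P') :
    expectedCramer P' Y ≤ expectedCramer P X := by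
  have hN : 0 < ((n : ℝ) + 1) / 2 := by positivity
  have hG := continuous_radCramer hN
  have hμ : IsProbabilityMeasure (P.map X) := Measure.isProbabilityMeasure_map hX
  have hp : IsProbabilityMeasure (radialExp n) :=
    hY.map_eq ▸ Measure.isProbabilityMeasure_map hY.aemeasurable
  obtain ⟨β, hβ, hexp, hmean⟩ := exists_exp_comparison hn hlc hrot hnd
  have hβ' : 0 < √((n : ℝ) + 1) := by positivity
  have hm : ∀ b : ℝ, Measurable fun x : EuclideanSpace ℝ (Fin n) =>
      ENNReal.ofReal (radCramer (((n : ℝ) + 1) / 2) (b * ‖x‖)) := fun b => by fun_prop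
  calc expectedCramer P' Y
      ≤ ∫⁻ ω, ENNReal.ofReal (radCramer (((n : ℝ) + 1) / 2) (√((n : ℝ) + 1) * ‖Y ω‖)) ∂P' := by
        refine lintegral_mono fun ω => ?_
        rw [hY.map_eq, ← EReal.real_coe_toENNReal]
        exact EReal.toENNReal_le_toENNReal (cramerTransform_le_radCramer hN hβ'
          (fun ξ => lintegral_exp_inner_radialExp hn hp)
          (fun ξ => lintegral_exp_inner_radialExp_eq_top hn hp) _)
    _ = ∫⁻ y, ENNReal.ofReal (radCramer (((n : ℝ) + 1) / 2) (√((n : ℝ) + 1) * ‖y‖))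
          ∂(P'.map Y) := (lintegral_map' (hm _).aemeasurable hY.aemeasurable).symm
    _ = ENNReal.ofReal (expMean n (radCramer (((n : ℝ) + 1) / 2))) := by
        rw [hY.map_eq, lintegral_radCramer_radialExp hn hp hN]
    _ ≤ ∫⁻ x, ENNReal.ofReal (radCramer (((n : ℝ) + 1) / 2) (β * ‖x‖)) ∂(P.map X) := hmean _ hN
    _ = ∫⁻ ω, ENNReal.ofReal (radCramer (((n : ℝ) + 1) / 2) (β * ‖X ω‖)) ∂P :=
        lintegral_map' (hm _).aemeasurable hX
    _ ≤ expectedCramer P X := by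
        refine lintegral_mono fun ω => ?_
        rw [← EReal.real_coe_toENNReal]
        exact EReal.toENNReal_le_toENNReal (radCramer_le_cramerTransform hN hβ hexp _)
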